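/- Let $\mathcal S=\mathcal B_1\times\dots\times\mathcal B_k$ (finite sets $\mathcal B_i$), let $\mathcal A$ be a finite action set and $\mathcal R\subset\mathbb R$ a finite reward set. Let $\mu(\cdot\mid s,a)$ be a transition kernel from $\mathcal S\times\mathcal A$ to $\mathcal S\times\mathcal R$ and $\pi$ a stationary policy; started in $s_0\in\mathcal S$ the system produces $A_1,S_1,R_1,A_2,S_2,R_2,\dots$ with $S_0=s_0$, $A_t\sim\pi(\cdot\mid S_{t-1})$, $(S_t,R_t)\sim\mu(\cdot\mid S_{t-1},A_t)$. Assume that the Markov chain $X_t=(A_t,S_t)$, $t\ge1$, on the set of pairs that it reaches with positive probability, is irreducible and essentially aperiodic (positive recurrence is then automatic, this set being finite). Fix a horizon $m\ge1$. Let $(A'_0,S'_0,R'_0,\dots,A'_m,S'_m,R'_m)$ have the stationary law $\nu$ of the chain $W_t=(Y_t,\dots,Y_{t+m})$, $Y_t=(A_t,S_t,R_t)$, and put $Z'=\sum_{i=1}^mR'_i$ and $\nu(s\mid z,a)=\nu(S'_0=s\mid Z'=z,A'_1=a)$ whenever $\nu(Z'=z,A'_1=a)>0$. For $n\ge0$ let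 $s^{z,a}_{0:n-1}$ be the sequence of those $S_i$, $0\le i<n$, for which $A_{i+1}=a$ and $R_{i+1}+\dots+R_{i+m}=z$. For $1\le i\le k$ and $\gamma_i\in(0,1)$, multi-alphabet Context Tree Weighting for factor $i$ assigns a probability to the sequence of $i$th factors of states $x_1,\dots,x_N\in\mathcal S$, the context of $x_{t,i}$ being $x_{t,i-1},x_{t,i-2},\dots,x_{t,1}$ (nearest factor first), as follows. In the full context tree of depth $i-1$, a node $u$ at depth $d$ is a value of the $d$ nearest factors $i-1,\dots,i-d$. Let $K_u$ be the Krichevsky–Trofimov probability of the sequence of those $x_{t,i}$ whose context passes through $u$: after $l$ symbols, the next symbol is predicted to be $b$ with probability $(\#b+\tfrac12)/(l+|\mathcal B_i|/2)$, where $\#b$ counts the earlier occurrences of $b$. Put $P_u=K_u$ if $u$ is a leaf and $P_u=\gamma_iK_u+(1-\gamma_i)\prod_{u'}P_{u'}$, over the children $u'$ of $u$, otherwise; the assigned probability $P^{(i)}(x_{1:N})$ is that of the root. (The usual weight is $\gamma_i=\tfrac12$.) Let $$\rho(s\mid x_{1:N})=\prod_{i=1}^k\textsc{ctw}(s_i\mid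 s_{<i},x_{1:N,1:i}),\qquad \textsc{ctw}(s_i\mid s_{<i},x_{1:N,1:i})=\frac{P^{(i)}(x_{1:N}s)}{P^{(i)}(x_{1:N})}.$$ Then for all $s\in\mathcal S$, $z\in\mathbb R$ and $a\in\mathcal A$ with $\nu(Z'=z,A'_1=a)>0$, the estimator $\rho(s\mid s^{z,a}_{0:n-1})$ converges in probability to $\nu(s\mid z,a)$ as $n\to\infty$; moreover its absolute error $f_n=|\rho(s\mid s^{z,a}_{0:n-1})-\nu(s\mid z,a)|$ converges stochastically to $0$ with rate $n^{-1/2}$: there is $c>0$ such that for all $n\ge1$ and $\delta\in(0,1]$, $$\mathbb P\Big(f_n\le\sqrt{\tfrac cn\ln\tfrac2\delta}\Big)\ge1-\delta .$$ -/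

import Mathlib

open MeasureTheory Filter Topology
open scoped ENNReal BigOperators

noncomputable section

/- ### The controlled system
`S`, `A` are the (finite) state and action spaces, `R` the finite set of possible rewards,
`μ s a` is the law of the next (state, reward) pair and `π` is a stationary policy.
A single observation is a triple `(action, next state, reward)`. -/

/-- The probability `π(a | s) * μ(s', r | s, a)` of observing `(a, s', r)` from state `s`. -/
def stepProb {S A : Type*} {R : Finset ℝ} (μ : S → A → PMF (S × R)) (π : S → PMF A)
    (s : S) (y : A × S × R) : ℝ≥0∞ :=
  π s y.1 * μ s y.1 y.2

/-- The state before the observation number `t` (observations being numbered from `0`),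
when the system starts in `s₀`. -/
def stateAt {S A : Type*} {R : Finset ℝ} (s₀ : S) (y : ℕ → A × S × R) : ℕ → S
  | 0 => s₀
  | t + 1 => (y t).2.1

/-- `Y` is an execution of the system from `s₀`: `Y t` is the triple
`(A_{t+1}, S_{t+1}, R_{t+1})`, and the finite-dimensional laws are those given by `μ`, `π`. -/
structure IsExecution {S A Ω : Type*} {R : Finset ℝ} [MeasurableSpace Ω]
    (μ : S → A → PMF (S × R)) (π : S → PMF A) (s₀ : S)
    (P : Measure Ω) (Y : ℕ → Ω → A × S × R) : Prop where
  measurableSet_eq : ∀ t y, MeasurableSet {ω | Y t ω = y}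
  prob_prefix : ∀ (n : ℕ) (y : ℕ → A × S × R),
    P {ω | ∀ t < n, Y t ω = y t} =
      ∏ t ∈ Finset.range n, stepProb μ π (stateAt s₀ y t) (y t)

/- ### The chain of (action, state) pairs -/

/-- The probability that the next (action, state) pair is `x`, from state `s`. -/
def pairProb {S A : Type*} {R : Finset ℝ} (μ : S → A → PMF (S × R)) (π : S → PMF A)
    (s : S) (x : A × S) : ℝ≥0∞ :=
  ∑ r : R, stepProb μ π s (x.1, x.2, r)

/-- Transition matrix of the chain `X_t = (A_t, S_t)`. -/
def pairMatrix {S A : Type*} {R : Finset ℝ} (μ : S → A → PMF (S × R)) (π : S → PMF A) :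
    Matrix (A × S) (A × S) ℝ≥0∞ :=
  fun x x' => pairProb μ π x.2 x'

/-- The state space of the chain `(A_t, S_t)`, `t ≥ 1`: the pairs that occur with positive
probability at some time `t ≥ 1` in an execution from `s₀`. -/
def pairSpace {S A : Type*} [Fintype S] [DecidableEq S] [Fintype A] [DecidableEq A]
    {R : Finset ℝ} (μ : S → A → PMF (S × R)) (π : S → PMF A) (s₀ : S) : Set (A × S) :=
  {x | ∃ x₁, 0 < pairProb μ π s₀ x₁ ∧ ∃ n : ℕ, 0 < (pairMatrix μ π ^ n) x₁ x}

/-- Irreducibility of the chain with transition matrix `M` on the set `C`. -/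
def IrreducibleOn {X : Type*} [Fintype X] [DecidableEq X]
    (M : Matrix X X ℝ≥0∞) (C : Set X) : Prop :=
  ∀ x ∈ C, ∀ x' ∈ C, ∃ n : ℕ, 1 ≤ n ∧ 0 < (M ^ n) x x'

/-- Essential aperiodicity on `C`: the possible return times to a state of `C` have greatest
common divisor `1`, or there are none (greatest common divisor `∞`). -/
def EssAperiodicOn {X : Type*} [Fintype X] [DecidableEq X]
    (M : Matrix X X ℝ≥0∞) (C : Set X) : Prop :=
  ∀ x ∈ C, (∀ n : ℕ, 1 ≤ n → ¬ 0 < (M ^ n) x x) ∨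
    ∀ d : ℕ, (∀ n : ℕ, 1 ≤ n → 0 < (M ^ n) x x → d ∣ n) → d = 1

/- ### The snake chain and its stationary distribution -/

/-- The state space of the chain of observations: the triples that have positive probability
after some pair of the state space of `(A_t, S_t)`. -/
def obsSpace {S A : Type*} [Fintype S] [DecidableEq S] [Fintype A] [DecidableEq A]
    {R : Finset ℝ} (μ : S → A → PMF (S × R)) (π : S → PMF A) (s₀ : S) : Set (A × S × R) :=
  {y | ∃ x ∈ pairSpace μ π s₀, 0 < stepProb μ π x.2 y}

/-- The state space of the snake chain `(Y_t, …, Y_{t+m})`. -/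
def snakeSpace {S A : Type*} [Fintype S] [DecidableEq S] [Fintype A] [DecidableEq A]
    {R : Finset ℝ} (μ : S → A → PMF (S × R)) (π : S → PMF A) (s₀ : S) (m : ℕ) :
    Set (Fin (m + 1) → A × S × R) :=
  {w | w 0 ∈ obsSpace μ π s₀ ∧
    ∀ j : Fin m, 0 < stepProb μ π (w j.castSucc).2.1 (w j.succ)}

open Classical in
/-- Transition probabilities of the snake chain: shift by one and append an observation. -/
def snakeProb {S A : Type*} {R : Finset ℝ} (μ : S → A → PMF (S × R)) (π : S → PMF A)
    {m : ℕ} (w w' : Fin (m + 1) → A × S × R) : ℝ≥0∞ :=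
  if ∀ j : Fin m, w' j.castSucc = w j.succ then
    stepProb μ π (w (Fin.last m)).2.1 (w' (Fin.last m))
  else 0

/-- `ν` is a stationary distribution of the snake chain on its state space. -/
def IsStationarySnake {S A : Type*} [Fintype S] [DecidableEq S] [Fintype A] [DecidableEq A]
    {R : Finset ℝ} (μ : S → A → PMF (S × R)) (π : S → PMF A) (s₀ : S) {m : ℕ}
    (ν : PMF (Fin (m + 1) → A × S × R)) : Prop :=
  ν.support ⊆ snakeSpace μ π s₀ m ∧ ∀ w', ν w' = ∑' w, ν w * snakeProb μ π w w'

/-- The return `Z' = R'_1 + … + R'_m` of `w = (A'_0, S'_0, R'_0, …, A'_m, S'_m, R'_m)`. -/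
def snakeReturn {S A : Type*} {R : Finset ℝ} {m : ℕ} (w : Fin (m + 1) → A × S × R) : ℝ :=
  ∑ j : Fin m, ((w j.succ).2.2 : ℝ)

/-- `ν(z, a)`, the probability of `Z' = z` and `A'_1 = a` (for `1 ≤ m`). -/
def nuReturnAction {S A : Type*} {R : Finset ℝ} {m : ℕ}
    (ν : PMF (Fin (m + 1) → A × S × R)) (z : ℝ) (a : A) : ℝ :=
  (ν.toOuterMeasure {w | snakeReturn w = z ∧ (w 1).1 = a}).toReal

/-- `ν(s | z, a)`, the conditional probability of `S'_0 = s` given `Z' = z` and `A'_1 = a`. -/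
def nuCond {S A : Type*} {R : Finset ℝ} {m : ℕ}
    (ν : PMF (Fin (m + 1) → A × S × R)) (s : S) (z : ℝ) (a : A) : ℝ :=
  (ν.toOuterMeasure {w | (w 0).2.1 = s ∧ snakeReturn w = z ∧ (w 1).1 = a}).toReal /
    nuReturnAction ν z a

/- ### The data in a bucket -/

open Classical in
/-- The sequence `s^{z,a}_{0:n-1}`: those of the states `s_0, …, s_{n-1}` whose next action is
`a` and whose following `m` rewards sum to `z`, in their order of occurrence. -/
def bucket {S A : Type*} {R : Finset ℝ} (s₀ : S) (m : ℕ) (y : ℕ → A × S × R)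
    (z : ℝ) (a : A) (n : ℕ) : List S :=
  ((List.range n).filter fun i =>
      (∑ j ∈ Finset.range m, ((y (i + j)).2.2 : ℝ)) = z ∧ (y i).1 = a).map (stateAt s₀ y)

/- ### Multi-alphabet context tree weighting -/

/-- The block probability of the Krichevsky–Trofimov estimator over the finite alphabet `α`:
given `t` symbols, symbol `x` is predicted with probability
`(number of earlier x + 1/2) / (t + |α|/2)`. -/
def ktProb {α : Type*} [Fintype α] [DecidableEq α] (xs : List α) : ℝ :=
  ∏ t : Fin xs.length,
    (((xs.take t).count (xs.get t) : ℝ) + 1 / 2) / ((t : ℝ) + (Fintype.card α : ℝ) / 2)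

/-- The weighted probability at a node of the context tree for factor `i`. The list `xs` holds
the data points whose context passes through the node, and the factors `r - 1, …, 0` are the
context symbols below the node. A node without further context symbols is a leaf. -/
def ctwNode {k : ℕ} {B : Fin k → Type*} [∀ i, Fintype (B i)] [∀ i, DecidableEq (B i)]
    (i : Fin k) (γ : ℝ) : (r : ℕ) → r ≤ k → List (∀ i, B i) → ℝ
  | 0, _, xs => ktProb (xs.map fun x => x i)
  | r + 1, h, xs =>
      γ * ktProb (xs.map fun x => x i) +
        (1 - γ) * ∏ b : B ⟨r, h⟩,
          ctwNode i γ r (Nat.le_of_succ_le h) (xs.filter fun x => x ⟨r, h⟩ = b)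

/-- The probability that context tree weighting assigns to the values of factor `i` along the
list `xs` of states; the context of `x i` is `x (i-1), …, x 0` (nearest factor first). -/
def ctwProb {k : ℕ} {B : Fin k → Type*} [∀ i, Fintype (B i)] [∀ i, DecidableEq (B i)]
    (i : Fin k) (γ : ℝ) (xs : List (∀ i, B i)) : ℝ :=
  ctwNode i γ i.val i.isLt.le xs

/-- The predictive probability of the value `s i`, in the context `s 0, …, s (i-1)`, after the
states `xs`. -/
def ctwPred {k : ℕ} {B : Fin k → Type*} [∀ i, Fintype (B i)] [∀ i, DecidableEq (B i)]
    (i : Fin k) (γ : ℝ) (xs : List (∀ i, B i)) (s : ∀ i, B i) : ℝ :=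
  ctwProb i γ (xs ++ [s]) / ctwProb i γ xs

/-- The factored estimator: the product of the predictive probabilities of the factors. -/
def factoredCTW {k : ℕ} {B : Fin k → Type*} [∀ i, Fintype (B i)] [∀ i, DecidableEq (B i)]
    (γ : Fin k → ℝ) (xs : List (∀ i, B i)) (s : ∀ i, B i) : ℝ :=
  ∏ i : Fin k, ctwPred i (γ i) xs s

/- ### Rate of stochastic convergence -/

/-- `f n` converges stochastically to `0` with rate `n^{-1/2}`. -/
def StochasticRateSqrt {Ω : Type*} [MeasurableSpace Ω] (P : Measure Ω)
    (f : ℕ → Ω → ℝ) : Prop :=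
  ∃ c : ℝ, 0 < c ∧ ∀ n : ℕ, 1 ≤ n → ∀ δ : ℝ, 0 < δ → δ ≤ 1 →
    1 - δ ≤ P.real {ω | |f n ω| ≤ Real.sqrt (c / n * Real.log (2 / δ))}

end

/-! The argument splits into a deterministic and a probabilistic half, joined by a union bound. Put
v(x) = ν(S'_0 = x, Z' = z, A'_1 = a), which is `bucketMean`, so that the target is v(s) / ∑ v.

Deterministic half (`exists_abs_factoredCTW_sub_le`): if every state x occurs in the data n v(x) ±
εn times, the estimator is within L(ε + 1/n) of the target. At an inner node, context tree weighting
is a Bayes mixture of "stop here and use KT" and "split by the next factor", so its prediction is a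
convex combination with posterior weight `stopWeight` on stopping. Up to an error τn + C with τ
arbitrarily small, log KT is the maximal log-likelihood, a continuous function of the counts that is
homogeneous of degree one. By the mutual information inequality, splitting never lowers the
likelihood. Either it gains nothing under v, and then by the equality case the symbol is independent
of the context, so that stopping predicts the same limit; or it gains a positive amount per symbol,
and then the weight of stopping decays exponentially. Both ways the prediction tends to the
conditional probability in the full context, and the chain rule multiplies the factors together.

Probabilistic half (`exists_snake_concentration`): the snake chain of windows inherits
irreducibility from the pair chain, so harmonic functions on its class are constants and the Poisson
equation g - pg = f - ν(f) has a solution. It turns ∑ (f - ν(f)) along the path into a martingale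
with bounded increments plus bounded boundary terms. Bounding exponential moments one observation at
a time gives a sub-Gaussian tail.

Applied to the indicator of each state in the bucket, the two halves give P(error > τ) ≤ C
exp(-nτ²/c) (`exists_factoredCTW_tail`), and both claims follow from this tail. -/

/-! ### Entropy and Stirling estimates -/

/-- The mutual information inequality, with its case of equality, in terms of `x log x`. -/
theorem sum_mul_log_sub_le {β κ : Type*} [Fintype β] [Fintype κ] (p : β → κ → ℝ)
    (hp : ∀ b c, 0 ≤ p b c) :
    (∑ b, (∑ c, p b c) * Real.log (∑ c, p b c) -
        (∑ b, ∑ c, p b c) * Real.log (∑ b, ∑ c, p b c) ≤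
      ∑ c, (∑ b, p b c * Real.log (p b c) - (∑ b, p b c) * Real.log (∑ b, p b c))) ∧
    (∑ c, (∑ b, p b c * Real.log (p b c) - (∑ b, p b c) * Real.log (∑ b, p b c)) =
        ∑ b, (∑ c, p b c) * Real.log (∑ c, p b c) -
          (∑ b, ∑ c, p b c) * Real.log (∑ b, ∑ c, p b c) →
      ∀ b c, p b c * (∑ b, ∑ c, p b c) = (∑ c, p b c) * ∑ b, p b c) := by
  set t := ∑ b, ∑ c, p b c with ht
  set f : β → ℝ := fun b => ∑ c, p b c with hf
  set g : κ → ℝ := fun c => ∑ b, p b c with hg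
  have hsg : ∑ c, g c = t := by rw [ht, Finset.sum_comm]
  have hsf : ∑ b, f b = t := rfl
  have hpf : ∀ b c, p b c ≤ f b := fun b c =>
    Finset.single_le_sum (f := fun c => p b c) (fun c _ => hp b c) (Finset.mem_univ c)
  have hpg : ∀ b c, p b c ≤ g c := fun b c =>
    Finset.single_le_sum (f := fun b => p b c) (fun b _ => hp b c) (Finset.mem_univ b)
  have hf0 : ∀ b, 0 ≤ f b := fun b => Finset.sum_nonneg fun c _ => hp b c
  have hg0 : ∀ c, 0 ≤ g c := fun c => Finset.sum_nonneg fun b _ => hp b c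
  have ht0 : 0 ≤ t := Finset.sum_nonneg fun b _ => hf0 b
  have hft : ∀ b, f b ≤ t := fun b =>
    Finset.single_le_sum (f := f) (fun b _ => hf0 b) (Finset.mem_univ b)
  -- This is p log(pt / (fg)) - (p - fg/t), nonnegative because log x ≤ x - 1, with equality only at
  -- x = 1. The correction terms p and fg/t both have total t, so they cancel in the double sum.
  let T : β → κ → ℝ := fun b c => p b c * Real.log (p b c) + p b c * Real.log t -
    p b c * Real.log (f b) - p b c * Real.log (g c) - (p b c - f b * g c / t)
  have hT : ∀ b c, 0 ≤ T b c ∧ (T b c = 0 → p b c * t = f b * g c) := by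
    intro b c
    rcases (hp b c).eq_or_lt with h0 | hpos
    · have hT : T b c = f b * g c / t := by simp only [T, ← h0]; ring
      refine ⟨hT ▸ div_nonneg (mul_nonneg (hf0 b) (hg0 c)) ht0, fun h => ?_⟩
      rw [hT, div_eq_zero_iff] at h
      rcases h with h | h
      · rw [← h0, h, zero_mul]
      -- Here t = 0: the quotient vanished only through division by zero, but then all weights
      -- vanish.
      · have : f b = 0 := le_antisymm (h ▸ hft b) (hf0 b)
        rw [h, this]; simp
    · have hfb : 0 < f b := hpos.trans_le (hpf b c)
      have hgc : 0 < g c := hpos.trans_le (hpg b c)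
      have htp : 0 < t := hfb.trans_le (hft b)
      have hx : 0 < f b * g c / (p b c * t) := by positivity
      have hlog : Real.log (f b * g c / (p b c * t)) =
          Real.log (f b) + Real.log (g c) - Real.log (p b c) - Real.log t := by
        rw [Real.log_div (by positivity) (by positivity), Real.log_mul hfb.ne' hgc.ne',
          Real.log_mul hpos.ne' htp.ne']
        ring
      have hTx : T b c = p b c * (f b * g c / (p b c * t) - 1 -
          Real.log (f b * g c / (p b c * t))) := by
        rw [hlog]
        simp only [T]
        field_simp
        ring
      refine ⟨?_, fun h => ?_⟩
      · rw [hTx]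
        exact mul_nonneg hpos.le (by linarith [Real.log_le_sub_one_of_pos hx])
      · by_contra hne
        have hx1 : f b * g c / (p b c * t) ≠ 1 := by
          intro h1
          rw [div_eq_one_iff_eq (by positivity)] at h1
          exact hne h1.symm
        have := Real.log_lt_sub_one_of_pos hx hx1
        have h2 : 0 < T b c := by rw [hTx]; exact mul_pos hpos (by linarith)
        exact h2.ne' h
  have hsum : ∑ b, ∑ c, T b c =
      ∑ c, (∑ b, p b c * Real.log (p b c) - g c * Real.log (g c)) -
        (∑ b, f b * Real.log (f b) - t * Real.log t) := by
    have e1 : ∑ b, ∑ c, p b c * Real.log t = t * Real.log t := by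
      simp only [← Finset.sum_mul]; rfl
    have e2 : ∑ b, ∑ c, p b c * Real.log (f b) = ∑ b, f b * Real.log (f b) := by
      simp only [← Finset.sum_mul]; rfl
    have e3 : ∑ b, ∑ c, p b c * Real.log (g c) = ∑ c, g c * Real.log (g c) := by
      rw [Finset.sum_comm]; simp only [← Finset.sum_mul]; rfl
    have e4 : ∑ b, ∑ c, f b * g c / t = t := by
      simp only [← Finset.sum_div, ← Finset.mul_sum, ← Finset.sum_mul, hsg, hsf]
      rcases ht0.eq_or_lt with h | h
      · rw [← h]; simp
      · field_simp
    have e5 : ∑ b, ∑ c, p b c = t := rfl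
    simp only [T, Finset.sum_sub_distrib, Finset.sum_add_distrib, e1, e2, e3, e4, e5]
    rw [Finset.sum_comm (f := fun b c => p b c * Real.log (p b c))]
    ring
  have hnn : 0 ≤ ∑ b, ∑ c, T b c :=
    Finset.sum_nonneg fun b _ => Finset.sum_nonneg fun c _ => (hT b c).1
  refine ⟨by linarith, fun heq b c => (hT b c).2 ?_⟩
  have h0 : ∑ b, ∑ c, T b c = 0 := by rw [hsum, heq]; ring
  rw [Finset.sum_eq_zero_iff_of_nonneg
    fun b _ => Finset.sum_nonneg fun c _ => (hT b c).1] at h0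
  have h1 := h0 b (Finset.mem_univ b)
  rw [Finset.sum_eq_zero_iff_of_nonneg fun c _ => (hT b c).1] at h1
  exact h1 c (Finset.mem_univ c)

/-- `∑_{j<n} log (j + a)` is `n log n - n` up to a sublinear error. -/
theorem exists_abs_sum_log_sub_le {a : ℝ} (ha : 0 < a) {τ : ℝ} (hτ : 0 < τ) :
    ∃ C, ∀ n : ℕ,
      |∑ j ∈ Finset.range n, Real.log (j + a) - (n * Real.log n - n)| ≤ τ * n + C := by
  -- The difference between log(j + a) and the increment of x log x - x. It tends to 0, so by Cesàro
  -- its partial sums are o(n).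
  let u : ℕ → ℝ := fun j =>
    Real.log (j + a) - ((j + 1 : ℝ) * Real.log (j + 1) - j * Real.log j - 1)
  have hu : Tendsto u atTop (𝓝 0) := by
    have h1 : Tendsto (fun n : ℕ => (n : ℝ) * Real.log (1 + 1 / n)) atTop (𝓝 1) :=
      (Real.tendsto_mul_log_one_add_div_atTop 1).comp tendsto_natCast_atTop_atTop
    have hd : ∀ c : ℝ, Tendsto (fun n : ℕ => 1 + c / (n : ℝ)) atTop (𝓝 1) := fun c => by
      simpa using (tendsto_const_div_atTop_nhds_zero_nat c).const_add 1
    have hl : ∀ c : ℝ, Tendsto (fun n : ℕ => Real.log (1 + c / (n : ℝ))) atTop (𝓝 0) :=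
      fun c => by simpa using (hd c).log one_ne_zero
    have h2 : Tendsto (fun n : ℕ => Real.log (1 + a / (n : ℝ)) -
        (n * Real.log (1 + 1 / n) - 1) - Real.log (1 + 1 / (n : ℝ))) atTop (𝓝 0) := by
      simpa using ((hl a).sub (h1.sub_const 1)).sub (hl 1)
    refine h2.congr' ?_
    filter_upwards [eventually_gt_atTop 0] with n hn
    have hn' : (0 : ℝ) < n := by exact_mod_cast hn
    have e : ∀ c : ℝ, 0 < c → Real.log (1 + c / n) = Real.log (n + c) - Real.log n := by
      intro c hc
      rw [← Real.log_div (by positivity) hn'.ne']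
      congr 1
      field_simp
    simp only [u, e a ha, e 1 one_pos]
    ring
  have hsum : ∀ n : ℕ, ∑ j ∈ Finset.range n, u j =
      ∑ j ∈ Finset.range n, Real.log (j + a) - (n * Real.log n - n) := by
    intro n
    induction n with
    | zero => simp
    | succ n ih => rw [Finset.sum_range_succ, ih, Finset.sum_range_succ]; push_cast; ring
  have ho := (Asymptotics.isLittleO_sum_range_of_tendsto_zero hu).bound hτ
  obtain ⟨N, hN⟩ := eventually_atTop.1 ho
  -- The finitely many n < N at which the o(n) bound is not yet available are absorbed into the
  -- constant.
  refine ⟨∑ n ∈ Finset.range N, |∑ j ∈ Finset.range n, u j|, fun n => ?_⟩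
  rw [← hsum]
  rcases le_or_gt N n with h | h
  · have := hN n h
    simp only [Real.norm_eq_abs, Nat.abs_cast] at this
    have : 0 ≤ ∑ n ∈ Finset.range N, |∑ j ∈ Finset.range n, u j| :=
      Finset.sum_nonneg fun _ _ => abs_nonneg _
    linarith
  · have h3 : |∑ j ∈ Finset.range n, u j| ≤
        ∑ n ∈ Finset.range N, |∑ j ∈ Finset.range n, u j| :=
      Finset.single_le_sum (f := fun n => |∑ j ∈ Finset.range n, u j|)
        (fun _ _ => abs_nonneg _) (Finset.mem_range.2 h)
    have : 0 ≤ τ * n := by positivity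
    linarith

/-! ### Krichevsky–Trofimov probabilities -/

section KT
variable {α : Type*} [Fintype α] [DecidableEq α]

theorem ktProb_nil : ktProb ([] : List α) = 1 := by simp [ktProb]

theorem ktProb_append (xs : List α) (b : α) :
    ktProb (xs ++ [b]) = ktProb xs *
      (((xs.count b : ℝ) + 1 / 2) / ((xs.length : ℝ) + (Fintype.card α : ℝ) / 2)) := by
  -- The index type `Fin xs.length` depends on the list; with a free length n the product can be
  -- split at its last factor.
  have key : ∀ (n : ℕ) (ys : List α) (hn : ys.length = n), ktProb ys = ∏ t : Fin n,
      (((ys.take t).count (ys.get (t.cast hn.symm)) : ℝ) + 1 / 2) /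
        ((t : ℝ) + (Fintype.card α : ℝ) / 2) := by
    rintro n ys rfl
    rfl
  rw [key (xs.length + 1) (xs ++ [b]) (by simp), Fin.prod_univ_castSucc, ktProb]
  congr 1
  · refine Finset.prod_congr rfl fun t _ => ?_
    have ht := t.isLt
    simp [List.take_append, Nat.sub_eq_zero_of_le ht.le]
  · simp

theorem ktProb_pos [Nonempty α] (xs : List α) : 0 < ktProb xs := by
  have : (0 : ℝ) < Fintype.card α := by exact_mod_cast Fintype.card_pos
  exact Finset.prod_pos fun t _ => by positivity

/-- Each new symbol contributes the next factor to the product of its own count and the next factor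
to the product of denominators, so the block probability depends on the counts alone. -/
theorem ktProb_mul_prod [Nonempty α] (xs : List α) :
    ktProb xs * ∏ j ∈ Finset.range xs.length, ((j : ℝ) + (Fintype.card α : ℝ) / 2) =
      ∏ b, ∏ j ∈ Finset.range (xs.count b), ((j : ℝ) + 1 / 2) := by
  have hc : (0 : ℝ) < Fintype.card α := by exact_mod_cast Fintype.card_pos
  induction xs using List.reverseRecOn with
  | nil => simp [ktProb_nil]
  | append_singleton xs b ih =>
    have h1 : ∀ c, ∏ j ∈ Finset.range ((xs ++ [b]).count c), ((j : ℝ) + 1 / 2) =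
        (∏ j ∈ Finset.range (xs.count c), ((j : ℝ) + 1 / 2)) *
          if c = b then (xs.count b : ℝ) + 1 / 2 else 1 := by
      intro c
      by_cases h : c = b
      · subst h; simp [Finset.prod_range_succ]
      · simp [h, List.count_append, Ne.symm h]
    simp only [h1, Finset.prod_mul_distrib, Finset.prod_ite_eq', Finset.mem_univ, if_true]
    rw [← ih, ktProb_append, List.length_append, List.length_singleton, Finset.prod_range_succ]
    have : (0 : ℝ) < (xs.length : ℝ) + (Fintype.card α : ℝ) / 2 := by positivity
    field_simp

/-- The Krichevsky–Trofimov probability is the maximal likelihood up to a subexponential factor. -/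
theorem exists_abs_log_ktProb_sub_le [Nonempty α] {τ : ℝ} (hτ : 0 < τ) :
    ∃ C, ∀ xs : List α, |Real.log (ktProb xs) -
      (∑ b, (xs.count b : ℝ) * Real.log (xs.count b) - xs.length * Real.log xs.length)| ≤
        τ * xs.length + C := by
  have hc : (0 : ℝ) < Fintype.card α := by exact_mod_cast Fintype.card_pos
  obtain ⟨C₁, h₁⟩ := exists_abs_sum_log_sub_le (half_pos hc) (half_pos hτ)
  obtain ⟨C₂, h₂⟩ := exists_abs_sum_log_sub_le (a := 1 / 2) one_half_pos (half_pos hτ)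
  refine ⟨C₁ + Fintype.card α * C₂, fun xs => ?_⟩
  have hlen : ∑ b, (xs.count b : ℝ) = xs.length := by
    have := Multiset.sum_count_eq_card (s := Finset.univ) (m := (xs : Multiset α)) (by simp)
    simp only [Multiset.coe_count, Multiset.coe_card] at this
    exact_mod_cast this
  have hlog : Real.log (ktProb xs) =
      ∑ b, ∑ j ∈ Finset.range (xs.count b), Real.log ((j : ℝ) + 1 / 2) -
        ∑ j ∈ Finset.range xs.length, Real.log ((j : ℝ) + (Fintype.card α : ℝ) / 2) := by
    have h := congrArg Real.log (ktProb_mul_prod xs)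
    have hp : ∀ j ∈ Finset.range xs.length, (j : ℝ) + (Fintype.card α : ℝ) / 2 ≠ 0 :=
      fun j _ => by positivity
    rw [Real.log_mul (ktProb_pos xs).ne' (Finset.prod_ne_zero_iff.2 hp), Real.log_prod hp,
      Real.log_prod fun b _ => Finset.prod_ne_zero_iff.2 fun j _ => by positivity] at h
    rw [eq_sub_iff_add_eq, h]
    exact Finset.sum_congr rfl fun b _ => Real.log_prod fun j _ => by positivity
  have hre : Real.log (ktProb xs) -
      (∑ b, (xs.count b : ℝ) * Real.log (xs.count b) - xs.length * Real.log xs.length) =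
      ∑ b, (∑ j ∈ Finset.range (xs.count b), Real.log ((j : ℝ) + 1 / 2) -
        ((xs.count b : ℝ) * Real.log (xs.count b) - xs.count b)) -
      (∑ j ∈ Finset.range xs.length, Real.log ((j : ℝ) + (Fintype.card α : ℝ) / 2) -
        (xs.length * Real.log xs.length - xs.length)) := by
    rw [hlog]
    simp only [Finset.sum_sub_distrib, hlen]
    ring
  rw [hre]
  refine (abs_sub _ _).trans ?_
  have hs : |∑ b, (∑ j ∈ Finset.range (xs.count b), Real.log ((j : ℝ) + 1 / 2) -
        ((xs.count b : ℝ) * Real.log (xs.count b) - xs.count b))| ≤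
      τ / 2 * xs.length + Fintype.card α * C₂ := by
    refine (Finset.abs_sum_le_sum_abs _ _).trans
      ((Finset.sum_le_sum fun b _ => h₂ (xs.count b)).trans_eq ?_)
    rw [Finset.sum_add_distrib, ← Finset.mul_sum, hlen]
    simp
  linarith [h₁ xs.length]

end KT

/-! ### Maximal log-likelihood of a weight function -/

section LogLik
variable {X β : Type*} [Fintype X] [Fintype β] [DecidableEq β]

/-- The marginal under `e` of the weight function `v`. -/
noncomputable def marg (e : X → β) (v : X → ℝ) (b : β) : ℝ := ∑ x, if e x = b then v x else 0

/-- The part of the weight function `v` on the fibre of `e` over `b`. -/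
noncomputable def fibreWeight (e : X → β) (b : β) (v : X → ℝ) (x : X) : ℝ := if e x = b then v x else 0

/-- The maximal log-likelihood of i.i.d. data whose `e`-values have counts `marg e v`. -/
noncomputable def logLik (e : X → β) (v : X → ℝ) : ℝ :=
  ∑ b, marg e v b * Real.log (marg e v b) - (∑ x, v x) * Real.log (∑ x, v x)

omit [Fintype X] [Fintype β] in
theorem fibreWeight_nonneg (e : X → β) (b : β) {v : X → ℝ} (hv : ∀ x, 0 ≤ v x) (x : X) :
    0 ≤ fibreWeight e b v x := by
  unfold fibreWeight; split_ifs <;> simp [hv]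

omit [Fintype β] in
theorem marg_nonneg (e : X → β) {v : X → ℝ} (hv : ∀ x, 0 ≤ v x) (b : β) : 0 ≤ marg e v b :=
  Finset.sum_nonneg fun x _ => fibreWeight_nonneg e b hv x

theorem sum_marg (e : X → β) (v : X → ℝ) : ∑ b, marg e v b = ∑ x, v x := by
  unfold marg; rw [Finset.sum_comm]; simp

theorem marg_le_sum (e : X → β) {v : X → ℝ} (hv : ∀ x, 0 ≤ v x) (b : β) :
    marg e v b ≤ ∑ x, v x := by
  rw [← sum_marg e]
  exact Finset.single_le_sum (f := marg e v) (fun b _ => marg_nonneg e hv b) (Finset.mem_univ b)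

omit [Fintype X] [Fintype β] in
theorem fibreWeight_smul (e : X → β) (b : β) (c : ℝ) (v : X → ℝ) :
    fibreWeight e b (c • v) = c • fibreWeight e b v := by
  ext x; simp [fibreWeight]

omit [Fintype β] in
theorem marg_smul (e : X → β) (c : ℝ) (v : X → ℝ) (b : β) :
    marg e (c • v) b = c * marg e v b := by
  simp [marg, Finset.mul_sum]

/-- Scaling changes x log x by the linear term c log c · x, and these terms cancel because the
marginals have the same total as v. Likelihoods of counts thereby become n times likelihoods of
relative frequencies. -/
theorem logLik_smul (e : X → β) {c : ℝ} (hc : 0 < c) (v : X → ℝ) :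
    logLik e (c • v) = c * logLik e v := by
  have h : ∀ x : ℝ, c * x * Real.log (c * x) = c * (x * Real.log x) + c * Real.log c * x := by
    intro x
    rcases eq_or_ne x 0 with rfl | hx
    · simp
    · rw [Real.log_mul hc.ne' hx]; ring
  have ht : ∑ x, (c • v) x = c * ∑ x, v x := by simp [Finset.mul_sum]
  simp only [logLik, marg_smul, h, ht, Finset.sum_add_distrib, ← Finset.mul_sum, sum_marg]
  ring

omit [Fintype X] [Fintype β] in
theorem continuous_fibreWeight (e : X → β) (b : β) : Continuous (fibreWeight e b) := by
  refine continuous_pi fun x => ?_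
  unfold fibreWeight
  split_ifs <;> fun_prop

theorem continuous_logLik (e : X → β) : Continuous (logLik e) := by
  have hm : ∀ b, Continuous fun v => marg e v b := fun b =>
    continuous_finsetSum _ fun x _ => (continuous_apply x).comp (continuous_fibreWeight e b)
  have ht : Continuous fun v : X → ℝ => ∑ x, v x := by fun_prop
  exact (continuous_finsetSum _ fun b _ => Real.continuous_mul_log.comp (hm b)).sub
    (Real.continuous_mul_log.comp ht)

variable {κ : Type*} [Fintype κ] [DecidableEq κ]

/-- The mutual information inequality for the joint table of e and c: the gain from splitting by c
is the mutual information times the total weight, and zero gain means independence. -/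
theorem logLik_le_sum_fibreWeight (e : X → β) (c : X → κ) {v : X → ℝ} (hv : ∀ x, 0 ≤ v x) :
    logLik e v ≤ ∑ d, logLik e (fibreWeight c d v) ∧
    (∑ d, logLik e (fibreWeight c d v) = logLik e v → ∀ d b,
      marg e (fibreWeight c d v) b * ∑ x, v x =
        marg e v b * ∑ x, fibreWeight c d v x) := by
  have h1 : ∀ b, ∑ d, marg e (fibreWeight c d v) b = marg e v b := by
    intro b
    unfold marg fibreWeight
    rw [Finset.sum_comm]
    refine Finset.sum_congr rfl fun x _ => ?_
    split_ifs <;> simp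
  have h := sum_mul_log_sub_le (fun b d => marg e (fibreWeight c d v) b)
    (fun b d => marg_nonneg e (fibreWeight_nonneg c d hv) b)
  simp only [h1, sum_marg] at h
  exact ⟨h.1, fun heq d b => h.2 heq b d⟩

end LogLik

/-! ### From data to counts -/

section Counts
variable {X : Type*} [Fintype X] [DecidableEq X]

/-- The occurrence counts of a list, as a real weight function. -/
noncomputable def countWeight (xs : List X) (x : X) : ℝ := xs.count x

theorem sum_countWeight (xs : List X) : ∑ x, countWeight xs x = xs.length := by
  have := Multiset.sum_count_eq_card (s := Finset.univ) (m := (xs : Multiset X)) (by simp)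
  simp only [Multiset.coe_count, Multiset.coe_card] at this
  unfold countWeight
  exact_mod_cast this

omit [Fintype X] in
theorem countWeight_filter {β : Type*} [DecidableEq β] (e : X → β) (b : β) (xs : List X) :
    countWeight (xs.filter fun x => e x = b) = fibreWeight e b (countWeight xs) := by
  ext x
  unfold countWeight fibreWeight
  split_ifs with h
  · rw [List.count_filter (by simpa using h)]
  · rw [List.count_eq_zero.2 (by simp [h])]; simp

theorem marg_countWeight {β : Type*} [DecidableEq β] (e : X → β) (b : β) (xs : List X) :
    marg e (countWeight xs) b = (xs.map e).count b := by
  have h1 : marg e (countWeight xs) b = ∑ x, fibreWeight e b (countWeight xs) x := rfl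
  rw [h1, ← countWeight_filter, sum_countWeight, List.count, List.countP_map,
    List.countP_eq_length_filter]
  congr 2

theorem sum_length_filter {β : Type*} [Fintype β] [DecidableEq β] (e : X → β) (xs : List X) :
    ∑ b, ((xs.filter fun x => e x = b).length : ℝ) = xs.length := by
  simp only [← sum_countWeight, countWeight_filter]
  exact sum_marg e _

theorem exists_abs_log_ktProb_map_sub_le {β : Type*} [Fintype β] [DecidableEq β] [Nonempty β]
    (e : X → β) {τ : ℝ} (hτ : 0 < τ) :
    ∃ C, ∀ xs : List X, |Real.log (ktProb (xs.map e)) - logLik e (countWeight xs)| ≤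
        τ * xs.length + C := by
  obtain ⟨C, h⟩ := exists_abs_log_ktProb_sub_le (α := β) hτ
  refine ⟨C, fun xs => ?_⟩
  have := h (xs.map e)
  simpa only [logLik, marg_countWeight, sum_countWeight, List.length_map] using this

/-- The Krichevsky–Trofimov prediction is close to the limiting relative frequency. -/
theorem abs_ktPred_sub_le {β : Type*} [Fintype β] [DecidableEq β] [Nonempty β]
    (e : X → β) {v : X → ℝ} (hv : ∀ x, 0 ≤ v x) (ht : 0 < ∑ x, v x) (b : β) :
    ∃ L, 0 ≤ L ∧ ∀ (xs : List X) (n ε : ℝ), 0 < n → 0 ≤ ε →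
      (∀ x, |countWeight xs x - n * v x| ≤ ε * n) →
      |ktProb (xs.map e ++ [b]) / ktProb (xs.map e) - marg e v b / ∑ x, v x| ≤
        L * (ε + 1 / n) := by
  set t := ∑ x, v x with htdef
  set D : ℝ := (Fintype.card β : ℝ) with hD
  set c : ℝ := (Fintype.card X : ℝ) with hc
  have hD0 : 0 < D := by rw [hD]; exact_mod_cast Fintype.card_pos
  have hc0 : 0 ≤ c := by rw [hc]; positivity
  refine ⟨(3 * c + (1 + D)) / t, by positivity, fun xs n ε hn hε h => ?_⟩
  set p := marg e v b / t with hp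
  have hp0 : 0 ≤ p := div_nonneg (marg_nonneg e hv b) ht.le
  have hp1 : p ≤ 1 := div_le_one_of_le₀ (marg_le_sum e hv b) ht.le
  have hpt : p * t = marg e v b := div_mul_cancel₀ _ ht.ne'
  rw [ktProb_append, mul_div_cancel_left₀ _ (ktProb_pos _).ne', List.length_map]
  set l : ℝ := (xs.length : ℝ) with hl
  set q : ℝ := ((xs.map e).count b : ℝ) with hq
  have hl0 : 0 ≤ l := by rw [hl]; positivity
  have h1 : |q - n * marg e v b| ≤ c * (ε * n) := by
    rw [hq, ← marg_countWeight, marg, marg, Finset.mul_sum, ← Finset.sum_sub_distrib]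
    refine (Finset.abs_sum_le_sum_abs _ _).trans
      ((Finset.sum_le_sum (g := fun _ => ε * n) fun x _ => ?_).trans_eq (by simp [hc]))
    split_ifs
    · exact h x
    · simp; positivity
  have h2 : |l - n * t| ≤ c * (ε * n) := by
    rw [hl, ← sum_countWeight, htdef, Finset.mul_sum, ← Finset.sum_sub_distrib]
    exact (Finset.abs_sum_le_sum_abs _ _).trans
      ((Finset.sum_le_sum (g := fun _ => ε * n) fun x _ => h x).trans_eq (by simp [hc]))
  have hq0 : 0 ≤ q := by rw [hq]; positivity
  have hql : q ≤ l := by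
    rw [hq, hl]; exact_mod_cast List.count_le_length.trans_eq (List.length_map _)
  have hden : 0 < l + D / 2 := by positivity
  set K := (q + 1 / 2) / (l + D / 2) with hK
  have hD1 : 1 ≤ D := by rw [hD]; exact_mod_cast Fintype.card_pos
  have hK0 : 0 ≤ K := by positivity
  have hK1 : K ≤ 1 := div_le_one_of_le₀ (by linarith) hden.le
  have hKp : |K - p| ≤ 1 := abs_sub_le_iff.2 ⟨by linarith, by linarith⟩
  have h3 : |K - p| * (l + D / 2) ≤ 2 * (c * (ε * n)) + (1 + D) := by
    have e1 : |K - p| * (l + D / 2) =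
        |(q - n * marg e v b) - p * (l - n * t) + (1 / 2 - p * (D / 2))| := by
      conv_lhs => rw [← abs_of_pos hden, ← abs_mul]
      congr 1
      rw [sub_mul, hK, div_mul_cancel₀ _ hden.ne', ← hpt]
      ring
    rw [e1]
    have e2 : |p * (l - n * t)| ≤ c * (ε * n) := by
      rw [abs_mul, abs_of_nonneg hp0]
      exact (mul_le_of_le_one_left (abs_nonneg _) hp1).trans h2
    have e3 : |1 / 2 - p * (D / 2)| ≤ 1 + D := by
      rw [abs_le]; constructor <;> nlinarith
    refine (abs_add_le _ _).trans ?_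
    have := abs_sub (q - n * marg e v b) (p * (l - n * t))
    linarith
  -- When ε is large, l gives no useful lower bound for the denominator. Comparing with nt instead
  -- costs only cεn, since |K - p| ≤ 1.
  have h4 : |K - p| * (n * t) ≤ |K - p| * (l + D / 2) + c * (ε * n) := by
    have : n * t ≤ l + D / 2 + c * (ε * n) := by linarith [(abs_le.1 h2).1]
    have h5 := mul_le_mul_of_nonneg_left this (abs_nonneg (K - p))
    have h6 : |K - p| * (c * (ε * n)) ≤ c * (ε * n) :=
      mul_le_of_le_one_left (by positivity) hKp
    linarith
  have h7 : |K - p| * (n * t) ≤ (3 * c + (1 + D)) * (ε + 1 / n) * n := by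
    have e1 : (3 * c + (1 + D)) * (ε + 1 / n) * n =
      3 * (c * (ε * n)) + (1 + D) + (1 + D) * (ε * n) + 3 * c := by field_simp; ring
    have : 0 ≤ (1 + D) * (ε * n) := by positivity
    rw [e1]; linarith
  rw [div_mul_eq_mul_div, le_div_iff₀ ht]
  refine le_of_mul_le_mul_right ?_ hn
  linarith

end Counts

/-! ### Nodes of the context tree -/

section CTW
variable {k : ℕ} {B : Fin k → Type*} [∀ i, Fintype (B i)] [∀ i, DecidableEq (B i)]

/-- The sum of the maximal log-likelihoods of factor `i` over the leaves of the context tree. -/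
noncomputable def leafLogLik (i : Fin k) : (r : ℕ) → r ≤ k → ((∀ i, B i) → ℝ) → ℝ
  | 0, _, v => logLik (fun x => x i) v
  | r + 1, h, v => ∑ b : B ⟨r, h⟩,
      leafLogLik i r (Nat.le_of_succ_le h) (fibreWeight (fun x => x ⟨r, h⟩) b v)

/-- The weight of the states that agree with `s` in the factors below `r`. -/
noncomputable def prefixWeight (s : ∀ i, B i) (r : ℕ) (v : (∀ i, B i) → ℝ) : ℝ :=
  ∑ x, if ∀ j : Fin k, j.val < r → x j = s j then v x else 0

/-- The weight of the states that agree with `s` in factor `i` and in the factors below `r`. -/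
noncomputable def prefixSymbolWeight (i : Fin k) (s : ∀ i, B i) (r : ℕ) (v : (∀ i, B i) → ℝ) : ℝ :=
  prefixWeight s r (fibreWeight (fun x => x i) (s i) v)

omit [∀ i, Fintype (B i)] [∀ i, DecidableEq (B i)] in
theorem forall_lt_succ_iff (s x : ∀ i, B i) {r : ℕ} (h : r + 1 ≤ k) :
    (∀ j : Fin k, j.val < r + 1 → x j = s j) ↔
      (x ⟨r, h⟩ = s ⟨r, h⟩ ∧ ∀ j : Fin k, j.val < r → x j = s j) := by
  constructor
  · exact fun H => ⟨H _ (Nat.lt_succ_self r), fun j hj => H j (hj.trans (Nat.lt_succ_self r))⟩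
  · rintro ⟨H1, H2⟩ j hj
    rcases (Nat.lt_succ_iff.1 hj).eq_or_lt with e | e
    · have : j = ⟨r, h⟩ := Fin.ext e
      subst this; exact H1
    · exact H2 j e

theorem prefixWeight_zero (s : ∀ i, B i) (v : (∀ i, B i) → ℝ) :
    prefixWeight s 0 v = ∑ x, v x := by
  simp [prefixWeight]

theorem prefixWeight_succ (s : ∀ i, B i) {r : ℕ} (h : r + 1 ≤ k) (v : (∀ i, B i) → ℝ) :
    prefixWeight s (r + 1) v =
      prefixWeight s r (fibreWeight (fun x => x ⟨r, h⟩) (s ⟨r, h⟩) v) := by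
  unfold prefixWeight fibreWeight
  refine Finset.sum_congr rfl fun x _ => ?_
  simp only [forall_lt_succ_iff s x h]
  split_ifs <;> tauto

theorem prefixSymbolWeight_zero (i : Fin k) (s : ∀ i, B i) (v : (∀ i, B i) → ℝ) :
    prefixSymbolWeight i s 0 v = marg (fun x => x i) v (s i) := prefixWeight_zero _ _

omit [∀ i, Fintype (B i)] in
theorem fibreWeight_comm {β κ : Type*} [DecidableEq β] [DecidableEq κ] {X : Type*} (e : X → β)
    (c : X → κ) (b : β) (d : κ) (v : X → ℝ) :
    fibreWeight e b (fibreWeight c d v) = fibreWeight c d (fibreWeight e b v) := by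
  ext x; unfold fibreWeight; split_ifs <;> rfl

theorem prefixSymbolWeight_succ (i : Fin k) (s : ∀ i, B i) {r : ℕ} (h : r + 1 ≤ k)
    (v : (∀ i, B i) → ℝ) :
    prefixSymbolWeight i s (r + 1) v =
      prefixSymbolWeight i s r (fibreWeight (fun x => x ⟨r, h⟩) (s ⟨r, h⟩) v) := by
  unfold prefixSymbolWeight
  rw [prefixWeight_succ s h, fibreWeight_comm]

theorem prefixWeight_nonneg (s : ∀ i, B i) (r : ℕ) {v : (∀ i, B i) → ℝ} (hv : ∀ x, 0 ≤ v x) :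
    0 ≤ prefixWeight s r v :=
  Finset.sum_nonneg fun x _ => by split_ifs <;> simp [hv]

theorem prefixWeight_le_sum (s : ∀ i, B i) (r : ℕ) {v : (∀ i, B i) → ℝ} (hv : ∀ x, 0 ≤ v x) :
    prefixWeight s r v ≤ ∑ x, v x :=
  Finset.sum_le_sum fun x _ => by split_ifs <;> simp [hv]

theorem prefixSymbolWeight_le (i : Fin k) (s : ∀ i, B i) (r : ℕ) {v : (∀ i, B i) → ℝ}
    (hv : ∀ x, 0 ≤ v x) : prefixSymbolWeight i s r v ≤ prefixWeight s r v :=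
  Finset.sum_le_sum fun x _ => by unfold fibreWeight; split_ifs <;> simp [hv]

theorem leafLogLik_smul (i : Fin k) (r : ℕ) (h : r ≤ k) {c : ℝ} (hc : 0 < c)
    (v : (∀ i, B i) → ℝ) : leafLogLik i r h (c • v) = c * leafLogLik i r h v := by
  induction r generalizing v with
  | zero => exact logLik_smul _ hc v
  | succ r ih => simp only [leafLogLik, fibreWeight_smul, ih, Finset.mul_sum]

theorem continuous_leafLogLik (i : Fin k) (r : ℕ) (h : r ≤ k) :
    Continuous (leafLogLik (B := B) i r h) := by
  induction r with
  | zero => exact continuous_logLik _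
  | succ r ih =>
    exact continuous_finsetSum _ fun b _ => (ih _).comp (continuous_fibreWeight _ b)

/-- The mutual information inequality, iterated over the levels of the tree. -/
theorem logLik_le_leafLogLik (i : Fin k) (r : ℕ) (h : r ≤ k) {v : (∀ i, B i) → ℝ}
    (hv : ∀ x, 0 ≤ v x) : logLik (fun x => x i) v ≤ leafLogLik i r h v := by
  induction r generalizing v with
  | zero => exact le_rfl
  | succ r ih =>
    exact (logLik_le_sum_fibreWeight _ (fun x => x ⟨r, h⟩) hv).1.trans
      (Finset.sum_le_sum fun b _ => ih _ (fibreWeight_nonneg _ b hv))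

/-- If splitting into leaves does not gain likelihood, then the conditional probability of a
symbol at a leaf agrees with that at the node. -/
theorem prefixSymbolWeight_mul_of_leafLogLik_eq (i : Fin k) (r : ℕ) (h : r ≤ k)
    {v : (∀ i, B i) → ℝ} (hv : ∀ x, 0 ≤ v x) (s : ∀ i, B i) (hs : 0 < prefixWeight s r v)
    (heq : leafLogLik i r h v = logLik (fun x => x i) v) :
    prefixSymbolWeight i s r v / prefixWeight s r v =
      marg (fun x => x i) v (s i) / ∑ x, v x := by
  induction r generalizing v with
  | zero => rw [prefixSymbolWeight_zero, prefixWeight_zero]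
  | succ r ih =>
    have hnn := fun b => fibreWeight_nonneg (fun x : ∀ i, B i => x ⟨r, h⟩) b hv
    have hle := logLik_le_sum_fibreWeight (fun x : ∀ i, B i => x i) (fun x => x ⟨r, h⟩) hv
    have hle2 : ∀ b ∈ Finset.univ, logLik (fun x : ∀ i, B i => x i)
        (fibreWeight (fun x => x ⟨r, h⟩) b v) ≤
        leafLogLik i r (Nat.le_of_succ_le h) (fibreWeight (fun x => x ⟨r, h⟩) b v) :=
      fun b _ => logLik_le_leafLogLik i r _ (hnn b)
    have hsum := Finset.sum_le_sum hle2
    simp only [leafLogLik] at heq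
    -- The sandwich logLik v ≤ ∑ logLik (children) ≤ ∑ leafLogLik (children) = logLik v forces
    -- equality throughout. The first equality gives independence at this node, the second feeds the
    -- induction hypothesis at the child that contains s.
    have heq1 : ∑ b, logLik (fun x : ∀ i, B i => x i) (fibreWeight (fun x => x ⟨r, h⟩) b v) =
        logLik (fun x => x i) v := le_antisymm (hsum.trans_eq heq) hle.1
    have heq2 := (Finset.sum_eq_sum_iff_of_le hle2).1 (heq1.trans heq.symm)
    rw [prefixWeight_succ s h] at hs
    have hpos : 0 < ∑ x, fibreWeight (fun x => x ⟨r, h⟩) (s ⟨r, h⟩) v x :=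
      hs.trans_le (prefixWeight_le_sum s r (hnn _))
    have hposv : 0 < ∑ x, v x := hpos.trans_le (marg_le_sum (fun x : ∀ i, B i => x ⟨r, h⟩) hv (s ⟨r, h⟩))
    rw [prefixWeight_succ s h, prefixSymbolWeight_succ i s h,
      ih _ (hnn _) hs (heq2 _ (Finset.mem_univ _)).symm, div_eq_div_iff hpos.ne' hposv.ne']
    exact hle.2 heq1 _ _

theorem ctwNode_pos [∀ i, Nonempty (B i)] (i : Fin k) {γ : ℝ} (hγ : 0 < γ ∧ γ < 1) (r : ℕ)
    (h : r ≤ k) (xs : List (∀ i, B i)) : 0 < ctwNode i γ r h xs := by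
  induction r generalizing xs with
  | zero => exact ktProb_pos _
  | succ r ih =>
    have := sub_pos.2 hγ.2
    exact add_pos (mul_pos hγ.1 (ktProb_pos _))
      (mul_pos this (Finset.prod_pos fun b _ => ih _ _))

/-- The mixture is at least its split term. Always splitting costs a constant log(1 - γ) per inner
node, and at the leaves KT attains the maximal likelihood up to τn + C. -/
theorem exists_leafLogLik_le_log_ctwNode [∀ i, Nonempty (B i)] (i : Fin k) {γ : ℝ}
    (hγ : 0 < γ ∧ γ < 1) (r : ℕ) (h : r ≤ k) {τ : ℝ} (hτ : 0 < τ) :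
    ∃ C, ∀ xs : List (∀ i, B i), leafLogLik i r h (countWeight xs) - τ * xs.length - C ≤
      Real.log (ctwNode i γ r h xs) := by
  induction r with
  | zero =>
    obtain ⟨C, hC⟩ := exists_abs_log_ktProb_map_sub_le (fun x : ∀ i, B i => x i) hτ
    refine ⟨C, fun xs => ?_⟩
    have := (abs_le.1 (hC xs)).1
    simp only [leafLogLik, ctwNode]
    linarith
  | succ r ih =>
    obtain ⟨C, hC⟩ := ih (Nat.le_of_succ_le h)
    refine ⟨Fintype.card (B ⟨r, h⟩) * C - Real.log (1 - γ), fun xs => ?_⟩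
    have hg := sub_pos.2 hγ.2
    have hP : ∀ b, 0 < ctwNode i γ r (Nat.le_of_succ_le h)
        (xs.filter fun x => x ⟨r, h⟩ = b) := fun b => ctwNode_pos i hγ r _ _
    have h1 : Real.log ((1 - γ) * ∏ b : B ⟨r, h⟩, ctwNode i γ r (Nat.le_of_succ_le h)
        (xs.filter fun x => x ⟨r, h⟩ = b)) ≤ Real.log (ctwNode i γ (r + 1) h xs) := by
      refine Real.log_le_log (mul_pos hg (Finset.prod_pos fun b _ => hP b)) ?_
      simp only [ctwNode]
      exact le_add_of_nonneg_left (mul_pos hγ.1 (ktProb_pos _)).le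
    refine le_trans ?_ h1
    rw [Real.log_mul hg.ne' (Finset.prod_pos fun b _ => hP b).ne',
      Real.log_prod fun b _ => (hP b).ne']
    have h2 := Finset.sum_le_sum fun (b : B ⟨r, h⟩) (_ : b ∈ Finset.univ) =>
      hC (xs.filter fun x => x ⟨r, h⟩ = b)
    simp only [Finset.sum_sub_distrib, ← Finset.mul_sum, sum_length_filter] at h2
    simp only [leafLogLik, countWeight_filter] at h2 ⊢
    simp at h2 ⊢
    linarith

/-- The prediction of the weighted probability at a node. -/
noncomputable def nodePred (i : Fin k) (γ : ℝ) (r : ℕ) (h : r ≤ k) (xs : List (∀ i, B i)) (s : ∀ i, B i) : ℝ :=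
  ctwNode i γ r h (xs ++ [s]) / ctwNode i γ r h xs

/-- The posterior weight of stopping at an inner node of the context tree. -/
noncomputable def stopWeight (i : Fin k) (γ : ℝ) (r : ℕ) (h : r + 1 ≤ k) (xs : List (∀ i, B i)) : ℝ :=
  γ * ktProb (xs.map fun x => x i) / ctwNode i γ (r + 1) h xs

theorem nodePred_zero (i : Fin k) (γ : ℝ) (h : 0 ≤ k) (xs : List (∀ i, B i)) (s : ∀ i, B i) :
    nodePred i γ 0 h xs s =
      ktProb (xs.map (fun x => x i) ++ [s i]) / ktProb (xs.map fun x => x i) := by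
  simp [nodePred, ctwNode]

/-- Bayes' rule for the mixture. Appending s alters only the child whose context agrees with s, so
the prediction of the product over the children is that of this single child. -/
theorem nodePred_succ [∀ i, Nonempty (B i)] (i : Fin k) {γ : ℝ} (hγ : 0 < γ ∧ γ < 1) (r : ℕ)
    (h : r + 1 ≤ k) (xs : List (∀ i, B i)) (s : ∀ i, B i) :
    nodePred i γ (r + 1) h xs s = stopWeight i γ r h xs *
        (ktProb (xs.map (fun x => x i) ++ [s i]) / ktProb (xs.map fun x => x i)) +
      (1 - stopWeight i γ r h xs) * nodePred i γ r (Nat.le_of_succ_le h)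
        (xs.filter fun x => x ⟨r, h⟩ = s ⟨r, h⟩) s := by
  have hP : ∀ (b : B ⟨r, h⟩), 0 < ctwNode i γ r (Nat.le_of_succ_le h)
      (xs.filter fun x => x ⟨r, h⟩ = b) := fun b => ctwNode_pos i hγ r _ _
  have hK : 0 < ktProb (xs.map fun x => x i) := ktProb_pos _
  have hT := ctwNode_pos i hγ (r + 1) h xs
  have hprod : ∏ b : B ⟨r, h⟩, ctwNode i γ r (Nat.le_of_succ_le h)
      ((xs ++ [s]).filter fun x => x ⟨r, h⟩ = b) =
      (∏ b : B ⟨r, h⟩, ctwNode i γ r (Nat.le_of_succ_le h)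
        (xs.filter fun x => x ⟨r, h⟩ = b)) * nodePred i γ r (Nat.le_of_succ_le h)
        (xs.filter fun x => x ⟨r, h⟩ = s ⟨r, h⟩) s := by
    have e1 : ∀ b, ctwNode i γ r (Nat.le_of_succ_le h)
        ((xs ++ [s]).filter fun x => x ⟨r, h⟩ = b) =
        ctwNode i γ r (Nat.le_of_succ_le h) (xs.filter fun x => x ⟨r, h⟩ = b) *
        if b = s ⟨r, h⟩ then nodePred i γ r (Nat.le_of_succ_le h)
          (xs.filter fun x => x ⟨r, h⟩ = s ⟨r, h⟩) s else 1 := by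
      intro b
      rw [List.filter_append]
      split_ifs with hb
      · subst hb
        rw [nodePred, mul_div_cancel₀ _ (hP _).ne']
        simp
      · simp [Ne.symm hb]
    simp only [e1, Finset.prod_mul_distrib, Finset.prod_ite_eq', Finset.mem_univ, if_true]
  have h1 : 1 - stopWeight i γ r h xs = (1 - γ) * (∏ b : B ⟨r, h⟩,
      ctwNode i γ r (Nat.le_of_succ_le h) (xs.filter fun x => x ⟨r, h⟩ = b)) /
      ctwNode i γ (r + 1) h xs := by
    rw [stopWeight, eq_div_iff hT.ne', sub_mul, div_mul_cancel₀ _ hT.ne']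
    simp only [ctwNode]; ring
  rw [h1, stopWeight, nodePred]
  conv_lhs => rw [ctwNode, hprod]
  rw [List.map_append, List.map_singleton]
  field_simp

theorem stopWeight_mem [∀ i, Nonempty (B i)] (i : Fin k) {γ : ℝ} (hγ : 0 < γ ∧ γ < 1) (r : ℕ)
    (h : r + 1 ≤ k) (xs : List (∀ i, B i)) :
    0 ≤ stopWeight i γ r h xs ∧ stopWeight i γ r h xs ≤ 1 := by
  have hT := ctwNode_pos i hγ (r + 1) h xs
  have hP := Finset.prod_pos (s := Finset.univ) fun (b : B ⟨r, h⟩) _ =>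
    ctwNode_pos i hγ r (Nat.le_of_succ_le h) (xs.filter fun x => x ⟨r, h⟩ = b)
  refine ⟨div_nonneg (mul_pos hγ.1 (ktProb_pos _)).le hT.le, div_le_one_of_le₀ ?_ hT.le⟩
  simp only [ctwNode]
  exact le_add_of_nonneg_right (mul_pos (sub_pos.2 hγ.2) hP).le

theorem ktPred_mem {β : Type*} [Fintype β] [DecidableEq β] [Nonempty β] (xs : List β) (b : β) :
    0 ≤ ktProb (xs ++ [b]) / ktProb xs ∧ ktProb (xs ++ [b]) / ktProb xs ≤ 1 := by
  refine ⟨(div_pos (ktProb_pos _) (ktProb_pos _)).le, ?_⟩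
  have hD1 : (1 : ℝ) ≤ Fintype.card β := by exact_mod_cast Fintype.card_pos
  have : (xs.count b : ℝ) ≤ xs.length := by exact_mod_cast List.count_le_length
  rw [ktProb_append, mul_div_cancel_left₀ _ (ktProb_pos _).ne']
  exact div_le_one_of_le₀ (by linarith) (by positivity)

theorem nodePred_mem [∀ i, Nonempty (B i)] (i : Fin k) {γ : ℝ} (hγ : 0 < γ ∧ γ < 1) (r : ℕ)
    (h : r ≤ k) (xs : List (∀ i, B i)) (s : ∀ i, B i) :
    0 ≤ nodePred i γ r h xs s ∧ nodePred i γ r h xs s ≤ 1 := by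
  induction r generalizing xs with
  | zero => rw [nodePred_zero]; exact ktPred_mem _ _
  | succ r ih =>
    rw [nodePred_succ i hγ]
    have h1 := ih (Nat.le_of_succ_le h) (xs.filter fun x => x ⟨r, h⟩ = s ⟨r, h⟩)
    have h2 := ktPred_mem (xs.map fun x => x i) (s i)
    have h3 := stopWeight_mem i hγ r h xs
    constructor
    · have := mul_nonneg h3.1 h2.1
      have := mul_nonneg (sub_nonneg.2 h3.2) h1.1
      linarith
    · have := mul_le_mul_of_nonneg_left h2.2 h3.1
      have := mul_le_mul_of_nonneg_left h1.2 (sub_nonneg.2 h3.2)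
      linarith

end CTW

/-! ### Convergence of the tree predictions -/

section CTWConvergence
variable {k : ℕ} {B : Fin k → Type*} [∀ i, Fintype (B i)] [∀ i, DecidableEq (B i)]

/-- The posterior weight of stopping at a node that ought to be split decays. -/
theorem exists_stopWeight_le [∀ i, Nonempty (B i)] (i : Fin k) {γ : ℝ} (hγ : 0 < γ ∧ γ < 1)
    (r : ℕ) (h : r + 1 ≤ k) {v : (∀ i, B i) → ℝ} (hv : ∀ x, 0 ≤ v x)
    (hlt : logLik (fun x => x i) v < leafLogLik i (r + 1) h v) :
    ∃ L, 0 ≤ L ∧ ∀ (xs : List (∀ i, B i)) (n ε : ℝ), 0 < n → 0 ≤ ε →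
      (∀ x, |countWeight xs x - n * v x| ≤ ε * n) → stopWeight i γ r h xs ≤ L * (ε + 1 / n) := by
  set gap : ((∀ i, B i) → ℝ) → ℝ :=
    fun v => leafLogLik i (r + 1) h v - logLik (fun x => x i) v with hgap
  have hcont : Continuous gap := (continuous_leafLogLik i (r + 1) h).sub (continuous_logLik _)
  set Δ := gap v with hΔ
  have hΔ0 : 0 < Δ := sub_pos.2 hlt
  obtain ⟨η, hη, hball⟩ := Metric.continuousAt_iff.1 (hcont.continuousAt (x := v)) (Δ / 2)
    (half_pos hΔ0)
  -- For ε ≤ η' the relative counts lie in the ball where the gap is at least Δ/2, and the length is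
  -- at most nT. For ε > η' the trivial bound 1 is at most ε/η'.
  set η' := min (η / 2) 1 with hη'
  have hη'0 : 0 < η' := lt_min (half_pos hη) one_pos
  set T : ℝ := ∑ x, v x + (Fintype.card (∀ i, B i) : ℝ) with hT
  have hT0 : 0 < T := add_pos_of_nonneg_of_pos (Finset.sum_nonneg fun x _ => hv x)
    (by exact_mod_cast Fintype.card_pos)
  -- With this τ each of the two approximation errors costs at most nΔ/8 out of the gap nΔ/2,
  -- leaving nΔ/4.
  have hτ : 0 < Δ / (8 * T) := by positivity
  obtain ⟨C₁, hC₁⟩ := exists_abs_log_ktProb_map_sub_le (fun x : ∀ i, B i => x i) hτ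
  obtain ⟨C₂, hC₂⟩ := exists_leafLogLik_le_log_ctwNode (B := B) i hγ (r + 1) h hτ
  set C := Real.log γ + C₁ + C₂ with hC
  set L₀ := Real.exp C * (4 / Δ) with hL₀
  refine ⟨max (1 / η') L₀, le_max_of_le_left (by positivity), fun xs n ε hn hε hclose => ?_⟩
  rcases lt_or_ge η' ε with hlarge | hsmall
  · have h1 := (stopWeight_mem i hγ r h xs).2
    have h2 : 1 ≤ 1 / η' * ε := by
      rw [one_div_mul_eq_div, one_le_div hη'0]; exact hlarge.le
    have h3 : 1 / η' * ε ≤ max (1 / η') L₀ * (ε + 1 / n) :=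
      mul_le_mul (le_max_left _ _) (le_add_of_nonneg_right (by positivity)) hε
        (le_max_of_le_left (by positivity))
    linarith
  · have hscale : countWeight xs = n • (n⁻¹ • countWeight xs) := by
      rw [smul_smul, mul_inv_cancel₀ hn.ne', one_smul]
    have hdist : dist (n⁻¹ • countWeight xs) v < η := by
      refine lt_of_le_of_lt ?_ (lt_of_le_of_lt (min_le_left (η / 2) 1) (half_lt_self hη))
      refine (dist_pi_le_iff hη'0.le).2 fun x => ?_
      rw [Real.dist_eq, Pi.smul_apply, smul_eq_mul]
      have e : n⁻¹ * countWeight xs x - v x = (countWeight xs x - n * v x) / n := by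
        field_simp
      rw [e, abs_div, abs_of_pos hn, div_le_iff₀ hn]
      exact (hclose x).trans (mul_le_mul_of_nonneg_right hsmall hn.le)
    have hg1 : Δ / 2 ≤ gap (n⁻¹ • countWeight xs) := by
      have := (abs_lt.1 (hball hdist)).1
      rw [← hΔ] at this
      linarith
    have hg2 : gap (countWeight xs) = n * gap (n⁻¹ • countWeight xs) := by
      conv_lhs => rw [hscale]
      simp only [hgap, leafLogLik_smul i (r + 1) h hn, logLik_smul _ hn]
      ring
    have hg3 : n * (Δ / 2) ≤ leafLogLik i (r + 1) h (countWeight xs) -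
        logLik (fun x => x i) (countWeight xs) := by
      have := mul_le_mul_of_nonneg_left hg1 hn.le
      rwa [← hg2] at this
    have hlen : (xs.length : ℝ) ≤ n * T := by
      have h1 : ∀ x ∈ Finset.univ, countWeight xs x ≤ n * v x + n := fun x _ => by
        have h2 := (abs_le.1 (hclose x)).2
        have h3 : ε * n ≤ 1 * n :=
          mul_le_mul_of_nonneg_right (hsmall.trans (min_le_right _ _)) hn.le
        linarith
      have h2 := Finset.sum_le_sum h1
      rw [sum_countWeight, Finset.sum_add_distrib, ← Finset.mul_sum] at h2
      simp only [Finset.sum_const, Finset.card_univ, nsmul_eq_mul] at h2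
      rw [hT, mul_add, mul_comm n (Fintype.card _ : ℝ)]
      exact h2
    have hτl : Δ / (8 * T) * xs.length ≤ n * Δ / 8 := by
      have := mul_le_mul_of_nonneg_left hlen hτ.le
      refine this.trans_eq ?_
      field_simp
    have hKpos : 0 < ktProb (xs.map fun x => x i) := ktProb_pos _
    have hPpos := ctwNode_pos i hγ (r + 1) h xs
    have hlog : Real.log (stopWeight i γ r h xs) ≤ C - n * Δ / 4 := by
      rw [stopWeight, Real.log_div (mul_pos hγ.1 hKpos).ne' hPpos.ne',
        Real.log_mul hγ.1.ne' hKpos.ne']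
      have h1 := (abs_le.1 (hC₁ xs)).2
      have h2 := hC₂ xs
      linarith
    have hwpos : 0 < stopWeight i γ r h xs := div_pos (mul_pos hγ.1 hKpos) hPpos
    have hexp : stopWeight i γ r h xs ≤ L₀ * (1 / n) := by
      rw [← Real.exp_log hwpos]
      refine (Real.exp_le_exp.2 hlog).trans ?_
      rw [sub_eq_add_neg, Real.exp_add, hL₀, mul_assoc]
      refine mul_le_mul_of_nonneg_left ?_ (Real.exp_pos _).le
      have hx : 0 < n * Δ / 4 := by positivity
      have h1 : n * Δ / 4 ≤ Real.exp (n * Δ / 4) := by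
        linarith [Real.add_one_le_exp (n * Δ / 4)]
      rw [Real.exp_neg]
      refine (inv_anti₀ hx h1).trans_eq ?_
      field_simp
    refine hexp.trans (mul_le_mul (le_max_right _ _) ?_ (by positivity)
      (le_max_of_le_left (by positivity)))
    linarith

/-- The prediction at a node converges to the conditional probability in the full context. -/
theorem exists_abs_nodePred_sub_le [∀ i, Nonempty (B i)] (i : Fin k) {γ : ℝ}
    (hγ : 0 < γ ∧ γ < 1) (r : ℕ) (h : r ≤ k) {v : (∀ i, B i) → ℝ} (hv : ∀ x, 0 ≤ v x)
    (s : ∀ i, B i) (hs : 0 < prefixWeight s r v) :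
    ∃ L, 0 ≤ L ∧ ∀ (xs : List (∀ i, B i)) (n ε : ℝ), 0 < n → 0 ≤ ε →
      (∀ x, |countWeight xs x - n * v x| ≤ ε * n) →
      |nodePred i γ r h xs s - prefixSymbolWeight i s r v / prefixWeight s r v| ≤
        L * (ε + 1 / n) := by
  induction r generalizing v with
  | zero =>
    rw [prefixWeight_zero] at hs
    obtain ⟨L, hL, H⟩ := abs_ktPred_sub_le (fun x : ∀ i, B i => x i) hv hs (s i)
    refine ⟨L, hL, fun xs n ε hn hε hc => ?_⟩
    rw [nodePred_zero, prefixWeight_zero, prefixSymbolWeight_zero]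
    exact H xs n ε hn hε hc
  | succ r ih =>
    set θ := prefixSymbolWeight i s (r + 1) v / prefixWeight s (r + 1) v with hθ
    have hθ0 : 0 ≤ θ := div_nonneg (prefixWeight_nonneg s _ (fibreWeight_nonneg _ _ hv)) hs.le
    have hθ1 : θ ≤ 1 := div_le_one_of_le₀ (prefixSymbolWeight_le i s _ hv) hs.le
    have ht : 0 < ∑ x, v x := hs.trans_le (prefixWeight_le_sum s _ hv)
    obtain ⟨L₁, hL₁, H₁⟩ := abs_ktPred_sub_le (fun x : ∀ i, B i => x i) hv ht (s i)
    obtain ⟨L₂, hL₂, H₂⟩ := ih (Nat.le_of_succ_le h)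
      (fibreWeight_nonneg (fun x => x ⟨r, h⟩) (s ⟨r, h⟩) hv) (by rwa [← prefixWeight_succ])
    rw [← prefixWeight_succ, ← prefixSymbolWeight_succ] at H₂
    have H₂' : ∀ (xs : List (∀ i, B i)) (n ε : ℝ), 0 < n → 0 ≤ ε →
        (∀ x, |countWeight xs x - n * v x| ≤ ε * n) →
        |nodePred i γ r (Nat.le_of_succ_le h)
          (xs.filter fun x => x ⟨r, h⟩ = s ⟨r, h⟩) s - θ| ≤ L₂ * (ε + 1 / n) := by
      intro xs n ε hn hε hc
      refine H₂ _ n ε hn hε fun x => ?_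
      rw [countWeight_filter]
      unfold fibreWeight
      split_ifs
      · exact hc x
      · simp; positivity
    have hbound : ∀ (xs : List (∀ i, B i)), |nodePred i γ (r + 1) h xs s - θ| ≤
        stopWeight i γ r h xs *
          |ktProb (xs.map (fun x => x i) ++ [s i]) / ktProb (xs.map fun x => x i) - θ| +
        |nodePred i γ r (Nat.le_of_succ_le h)
          (xs.filter fun x => x ⟨r, h⟩ = s ⟨r, h⟩) s - θ| := by
      intro xs
      obtain ⟨hw0, hw1⟩ := stopWeight_mem i hγ r h xs
      rw [nodePred_succ i hγ]
      set w := stopWeight i γ r h xs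
      set a := ktProb (xs.map (fun x => x i) ++ [s i]) / ktProb (xs.map fun x => x i)
      set b := nodePred i γ r (Nat.le_of_succ_le h) (xs.filter fun x => x ⟨r, h⟩ = s ⟨r, h⟩) s
      have e : w * a + (1 - w) * b - θ = w * (a - θ) + (1 - w) * (b - θ) := by ring
      rw [e]
      refine (abs_add_le _ _).trans ?_
      rw [abs_mul, abs_mul, abs_of_nonneg hw0, abs_of_nonneg (sub_nonneg.2 hw1)]
      have := mul_le_of_le_one_left (abs_nonneg (b - θ)) (by linarith : 1 - w ≤ 1)
      linarith
    -- If splitting gains nothing under v, the KT prediction at this node already has limit θ and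
    -- the value of `stopWeight` is irrelevant. Otherwise `stopWeight` is itself O(ε + 1/n) and
    -- multiplies an error of at most 1.
    rcases (logLik_le_leafLogLik i (r + 1) h hv).eq_or_lt with heq | hlt
    · have hθu := prefixSymbolWeight_mul_of_leafLogLik_eq i (r + 1) h hv s hs heq.symm
      rw [← hθ] at hθu
      refine ⟨L₁ + L₂, add_nonneg hL₁ hL₂, fun xs n ε hn hε hc => (hbound xs).trans ?_⟩
      have h1 := H₁ xs n ε hn hε hc
      rw [← hθu] at h1
      have h2 := mul_le_of_le_one_left (abs_nonneg
        (ktProb (xs.map (fun x => x i) ++ [s i]) / ktProb (xs.map fun x => x i) - θ))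
        (stopWeight_mem i hγ r h xs).2
      rw [add_mul]
      linarith [H₂' xs n ε hn hε hc]
    · obtain ⟨L₃, hL₃, H₃⟩ := exists_stopWeight_le i hγ r h hv hlt
      refine ⟨L₃ + L₂, add_nonneg hL₃ hL₂, fun xs n ε hn hε hc => (hbound xs).trans ?_⟩
      have h1 := H₃ xs n ε hn hε hc
      have hk := ktPred_mem (xs.map fun x => x i) (s i)
      have h2 := mul_le_of_le_one_right (stopWeight_mem i hγ r h xs).1
        (abs_sub_le_iff.2 ⟨by linarith, by linarith⟩ :
          |ktProb (xs.map (fun x => x i) ++ [s i]) / ktProb (xs.map fun x => x i) - θ| ≤ 1)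
      rw [add_mul]
      linarith [H₂' xs n ε hn hε hc]

/-- Makes the conditional probabilities of successive factors telescope in the chain rule. -/
theorem prefixSymbolWeight_self (i : Fin k) (s : ∀ i, B i) (v : (∀ i, B i) → ℝ) :
    prefixSymbolWeight i s i.val v = prefixWeight s (i.val + 1) v :=
  (prefixWeight_succ s i.isLt v).symm

theorem prefixWeight_last (s : ∀ i, B i) (v : (∀ i, B i) → ℝ) : prefixWeight s k v = v s := by
  unfold prefixWeight
  have : ∀ x : ∀ i, B i, (∀ j : Fin k, j.val < k → x j = s j) ↔ x = s :=
    fun x => ⟨fun H => funext fun j => H j j.isLt, fun H j _ => H ▸ rfl⟩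
  simp only [this, Finset.sum_ite_eq', Finset.mem_univ, if_true]

theorem prefixWeight_succ_le (s : ∀ i, B i) (r : ℕ) {v : (∀ i, B i) → ℝ} (hv : ∀ x, 0 ≤ v x) :
    prefixWeight s (r + 1) v ≤ prefixWeight s r v := by
  refine Finset.sum_le_sum fun x _ => ?_
  split_ifs with h1 h2
  · exact le_rfl
  · exact absurd (fun j hj => h1 j (Nat.lt_succ_of_lt hj)) h2
  · exact hv x
  · exact le_rfl

/-- If the relative counts of the data are close to `v`, then the factored estimator is close
to the normalization of `v`. -/
theorem exists_abs_factoredCTW_sub_le [∀ i, Nonempty (B i)] {γ : Fin k → ℝ}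
    (hγ : ∀ i, 0 < γ i ∧ γ i < 1) {v : (∀ i, B i) → ℝ} (hv : ∀ x, 0 ≤ v x)
    (ht : 0 < ∑ x, v x) (s : ∀ i, B i) :
    ∃ L, 0 ≤ L ∧ ∀ (xs : List (∀ i, B i)) (n ε : ℝ), 0 < n → 0 ≤ ε →
      (∀ x, |countWeight xs x - n * v x| ≤ ε * n) →
      |factoredCTW γ xs s - v s / ∑ x, v x| ≤ L * (ε + 1 / n) := by
  have key : ∀ r : ℕ, r ≤ k → ∃ L, 0 ≤ L ∧ ∀ (xs : List (∀ i, B i)) (n ε : ℝ), 0 < n → 0 ≤ ε →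
      (∀ x, |countWeight xs x - n * v x| ≤ ε * n) →
      |∏ i with i.val < r, ctwPred i (γ i) xs s - prefixWeight s r v / ∑ x, v x| ≤
        L * (ε + 1 / n) := by
    intro r
    induction r with
    | zero =>
      intro _
      refine ⟨0, le_rfl, fun xs n ε _ _ _ => ?_⟩
      simp [prefixWeight_zero, div_self ht.ne']
    | succ r ih =>
      intro h
      obtain ⟨L₁, hL₁, H₁⟩ := ih (Nat.le_of_succ_le h)
      have hprod : ∀ xs, ∏ i with i.val < r + 1, ctwPred i (γ i) xs s =
          ctwPred ⟨r, h⟩ (γ ⟨r, h⟩) xs s * ∏ i with i.val < r, ctwPred i (γ i) xs s := by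
        intro xs
        have hset : Finset.univ.filter (fun i : Fin k => i.val < r + 1) =
            insert ⟨r, h⟩ (Finset.univ.filter fun i : Fin k => i.val < r) := by
          ext j
          simp only [Finset.mem_filter, Finset.mem_univ, true_and, Finset.mem_insert,
            Fin.ext_iff]
          omega
        rw [hset, Finset.prod_insert (by simp)]
      have hm : ∀ xs (i : Fin k), 0 ≤ ctwPred i (γ i) xs s ∧ ctwPred i (γ i) xs s ≤ 1 :=
        fun xs i => nodePred_mem i (hγ i) i.val i.isLt.le xs s
      -- A context of weight zero leaves the next prediction uncontrolled. This does no harm: the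
      -- product so far is already small and the further factor is at most 1.
      rcases (prefixWeight_nonneg s r hv).eq_or_lt with h0 | hpos
      · have h1 : prefixWeight s (r + 1) v = 0 := le_antisymm
          (h0 ▸ prefixWeight_succ_le s r hv) (prefixWeight_nonneg s _ hv)
        refine ⟨L₁, hL₁, fun xs n ε hn hε hc => ?_⟩
        have h2 := H₁ xs n ε hn hε hc
        rw [← h0, zero_div, sub_zero] at h2
        rw [h1, zero_div, sub_zero, hprod, abs_mul, abs_of_nonneg (hm xs _).1]
        exact (mul_le_of_le_one_left (abs_nonneg _) (hm xs _).2).trans h2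
      · obtain ⟨L₂, hL₂, H₂⟩ := exists_abs_nodePred_sub_le ⟨r, h⟩ (hγ ⟨r, h⟩) r
          (Nat.le_of_succ_le h) hv s hpos
        refine ⟨L₁ + L₂, add_nonneg hL₁ hL₂, fun xs n ε hn hε hc => ?_⟩
        have h1 := H₁ xs n ε hn hε hc
        have h2 : |ctwPred ⟨r, h⟩ (γ ⟨r, h⟩) xs s -
            prefixWeight s (r + 1) v / prefixWeight s r v| ≤ L₂ * (ε + 1 / n) := by
          rw [← prefixSymbolWeight_self ⟨r, h⟩]
          exact H₂ xs n ε hn hε hc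
        set p := ctwPred ⟨r, h⟩ (γ ⟨r, h⟩) xs s
        set P := ∏ i with i.val < r, ctwPred i (γ i) xs s
        set t := ∑ x, v x
        have hp := hm xs ⟨r, h⟩
        have e : p * P - prefixWeight s (r + 1) v / t = p * (P - prefixWeight s r v / t) +
            (p - prefixWeight s (r + 1) v / prefixWeight s r v) * (prefixWeight s r v / t) := by
          field_simp
          ring
        rw [hprod, e]
        refine (abs_add_le _ _).trans ?_
        have hq0 : 0 ≤ prefixWeight s r v / t := by positivity
        have hq1 : prefixWeight s r v / t ≤ 1 :=
          div_le_one_of_le₀ (prefixWeight_le_sum s r hv) ht.le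
        rw [abs_mul, abs_mul, abs_of_nonneg hp.1, abs_of_nonneg hq0, add_mul]
        exact add_le_add ((mul_le_of_le_one_left (abs_nonneg _) hp.2).trans h1)
          ((mul_le_of_le_one_right (abs_nonneg _) hq1).trans h2)
  obtain ⟨L, hL, H⟩ := key k le_rfl
  refine ⟨L, hL, fun xs n ε hn hε hc => ?_⟩
  have := H xs n ε hn hε hc
  simp only [prefixWeight_last, Fin.is_lt, Finset.filter_true] at this
  exact this

end CTWConvergence

/-! ### The Poisson equation of a finite chain -/

section Poisson
variable {X : Type*} [Fintype X]

/-- The maximum principle: harmonic functions are constant on an irreducible class. -/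
theorem exists_const_of_harmonic (p : X → X → ℝ) (hp : ∀ x x', 0 ≤ p x x') {C : Set X}
    (hne : C.Nonempty) (hclosed : ∀ x ∈ C, ∀ x', 0 < p x x' → x' ∈ C)
    (hsum : ∀ x ∈ C, ∑ x', p x x' = 1)
    (hirr : ∀ x ∈ C, ∀ x' ∈ C, Relation.ReflTransGen (fun a b => 0 < p a b) x x')
    (h : X → ℝ) (hh : ∀ x ∈ C, h x = ∑ x', p x x' * h x') : ∃ c, ∀ x ∈ C, h x = c := by
  obtain ⟨x₀, hx₀, hmax⟩ := Set.exists_max_image C h (Set.toFinite C) hne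
  refine ⟨h x₀, fun x hx => ?_⟩
  suffices H : x ∈ C ∧ h x = h x₀ from H.2
  induction hirr x₀ hx₀ x hx with
  | refl => exact ⟨hx₀, rfl⟩
  | @tail b c _ hbc ih =>
    have hb : b ∈ C := by
      rename_i hab
      clear hbc ih
      induction hab with
      | refl => exact hx₀
      | tail _ hbc ih => exact hclosed _ ih _ hbc
    obtain ⟨-, hbm⟩ := ih hb
    refine ⟨hclosed b hb c hbc, ?_⟩
    have h0 : ∑ x', p b x' * (h x₀ - h x') = 0 := by
      simp only [mul_sub, Finset.sum_sub_distrib, ← Finset.sum_mul, hsum b hb, ← hh b hb, hbm]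
      ring
    have hnn : ∀ x' ∈ Finset.univ, 0 ≤ p b x' * (h x₀ - h x') := by
      intro x' _
      rcases (hp b x').eq_or_lt with h0 | hpos
      · rw [← h0, zero_mul]
      · exact mul_nonneg hpos.le (sub_nonneg.2 (hmax x' (hclosed b hb x' hpos)))
    have := (Finset.sum_eq_zero_iff_of_nonneg hnn).1 h0 c (Finset.mem_univ c)
    rcases mul_eq_zero.1 this with h1 | h1
    · exact absurd h1 hbc.ne'
    · linarith

/-- The Poisson equation of a finite irreducible chain is solvable. -/
theorem exists_poisson (p : X → X → ℝ) (hp : ∀ x x', 0 ≤ p x x') {C : Set X}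
    (hclosed : ∀ x ∈ C, ∀ x', 0 < p x x' → x' ∈ C) (hsum : ∀ x ∈ C, ∑ x', p x x' = 1)
    (hirr : ∀ x ∈ C, ∀ x' ∈ C, Relation.ReflTransGen (fun a b => 0 < p a b) x x')
    (w : X → ℝ) (hw0 : ∀ x, x ∉ C → w x = 0) (hw1 : ∑ x, w x = 1)
    (hstat : ∀ x', w x' = ∑ x, w x * p x x') (f : X → ℝ) :
    ∃ g : X → ℝ, ∀ x ∈ C, g x - ∑ x', p x x' * g x' = f x - ∑ x, w x * f x := by
  classical
  have hne : C.Nonempty := by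
    by_contra hC
    rw [Set.not_nonempty_iff_eq_empty] at hC
    have : ∑ x, w x = 0 := Finset.sum_eq_zero fun x _ => hw0 x (by simp [hC])
    rw [this] at hw1
    exact zero_ne_one hw1
  -- off `C` the chain is made to jump to the stationary distribution
  let p' : X → X → ℝ := fun x x' => if x ∈ C then p x x' else w x'
  let T : (X → ℝ) →ₗ[ℝ] (X → ℝ) :=
    { toFun := fun g x => g x - ∑ x', p' x x' * g x'
      map_add' := fun g g' => by
        ext x; simp only [Pi.add_apply, mul_add, Finset.sum_add_distrib]; ring
      map_smul' := fun c g => by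
        ext x
        simp only [Pi.smul_apply, smul_eq_mul, RingHom.id_apply, mul_sub, Finset.mul_sum]
        congr 1
        exact Finset.sum_congr rfl fun _ _ => by ring }
  let φ : (X → ℝ) →ₗ[ℝ] ℝ :=
    { toFun := fun g => ∑ x, w x * g x
      map_add' := fun g g' => by simp [mul_add, Finset.sum_add_distrib]
      map_smul' := fun c g => by
        simp only [Pi.smul_apply, smul_eq_mul, RingHom.id_apply, Finset.mul_sum]
        exact Finset.sum_congr rfl fun _ _ => by ring }
  -- The maximum principle gives a constant on C; off C the modified chain averages over w, which
  -- lives on C, so the same constant appears there.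
  have hker : LinearMap.ker T ≤ Submodule.span ℝ {fun _ => (1 : ℝ)} := by
    intro h hh
    have hT : ∀ x, h x = ∑ x', p' x x' * h x' := fun x => sub_eq_zero.1 (congrFun hh x)
    obtain ⟨c, hc⟩ := exists_const_of_harmonic p hp hne hclosed hsum hirr h fun x hx => by
      conv_lhs => rw [hT x]
      simp [p', hx]
    rw [Submodule.mem_span_singleton]
    refine ⟨c, ?_⟩
    ext x
    by_cases hx : x ∈ C
    · simp [hc x hx]
    · rw [hT x]
      simp only [p', hx, if_false, Pi.smul_apply, smul_eq_mul, mul_one]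
      have : ∀ x', w x' * h x' = w x' * c := fun x' => by
        by_cases hx' : x' ∈ C
        · rw [hc x' hx']
        · rw [hw0 x' hx']; ring
      simp only [this, ← Finset.sum_mul, hw1, one_mul]
  have hrange : LinearMap.range T ≤ LinearMap.ker φ := by
    rintro _ ⟨g, rfl⟩
    show ∑ x, w x * (g x - ∑ x', p' x x' * g x') = 0
    simp only [mul_sub, Finset.sum_sub_distrib, Finset.mul_sum]
    rw [Finset.sum_comm, ← Finset.sum_sub_distrib]
    refine Finset.sum_eq_zero fun x' _ => ?_
    have : ∀ x, w x * (p' x x' * g x') = w x * p x x' * g x' := fun x => by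
      by_cases hx : x ∈ C
      · simp [p', hx]; ring
      · simp [hw0 x hx]
    simp only [this, ← Finset.sum_mul, ← hstat x', sub_self]
  have hφ : Module.finrank ℝ (LinearMap.range φ) = 1 := by
    have : LinearMap.range φ = ⊤ := by
      refine LinearMap.range_eq_top.2 fun c => ⟨fun _ => c, ?_⟩
      show ∑ x, w x * c = c
      rw [← Finset.sum_mul, hw1, one_mul]
    rw [this, finrank_top, Module.finrank_self]
  -- Stationarity gives one inclusion. The kernel of T has dimension at most 1, so its range has
  -- codimension at most 1, the codimension of the kernel of φ.
  have heq : LinearMap.range T = LinearMap.ker φ := by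
    refine Submodule.eq_of_le_of_finrank_le hrange ?_
    have h1 := LinearMap.finrank_range_add_finrank_ker T
    have h2 := LinearMap.finrank_range_add_finrank_ker φ
    have h3 : Module.finrank ℝ (LinearMap.ker T) ≤ 1 :=
      (Submodule.finrank_mono hker).trans ((finrank_span_le_card _).trans (by simp))
    omega
  have hf : (fun x => f x - ∑ x, w x * f x) ∈ LinearMap.ker φ := by
    show ∑ x, w x * (f x - ∑ x, w x * f x) = 0
    simp only [mul_sub, Finset.sum_sub_distrib, ← Finset.sum_mul, hw1, one_mul, sub_self]
  rw [← heq] at hf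
  obtain ⟨g, hg⟩ := hf
  refine ⟨g, fun x hx => ?_⟩
  have h1 : g x - ∑ x', p' x x' * g x' = f x - ∑ x, w x * f x := congrFun hg x
  simpa [p', hx] using h1

end Poisson

/-! ### Exponential moments -/

/-- For |x| ≤ 1 this follows from exp x ≤ 1 + x + x² and 1 + x² ≤ exp(x²). Its use is that the
linear term disappears on averaging a centred variable. -/
theorem Real.exp_le_add_exp_sq (x : ℝ) : Real.exp x ≤ x + Real.exp (x ^ 2) := by
  have h1 := Real.add_one_le_exp (x ^ 2)
  rcases le_or_gt |x| 1 with h | h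
  · have := (abs_le.1 (Real.abs_exp_sub_one_sub_id_le h)).2
    linarith
  · rcases lt_abs.1 h with h | h
    · have : Real.exp x ≤ Real.exp (x ^ 2) := Real.exp_le_exp.2 (by nlinarith)
      linarith
    · have : Real.exp x ≤ 1 := Real.exp_le_one_iff.2 (by linarith)
      nlinarith

theorem sum_mul_exp_le {ι : Type*} [Fintype ι] (p X : ι → ℝ) (hp : ∀ i, 0 ≤ p i)
    (hp1 : ∑ i, p i = 1) (hX : ∑ i, p i * X i = 0) {K : ℝ} (hK : ∀ i, |X i| ≤ K) (l : ℝ) :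
    ∑ i, p i * Real.exp (l * X i) ≤ Real.exp (l ^ 2 * K ^ 2) := by
  have h : ∀ i, p i * Real.exp (l * X i) ≤
      l * (p i * X i) + p i * Real.exp (l ^ 2 * K ^ 2) := by
    intro i
    have h1 : (l * X i) ^ 2 ≤ l ^ 2 * K ^ 2 := by
      rw [mul_pow]
      exact mul_le_mul_of_nonneg_left
        (sq_le_sq' (neg_le_of_abs_le (hK i)) (le_of_abs_le (hK i))) (sq_nonneg l)
    have h2 := mul_le_mul_of_nonneg_left
      ((Real.exp_le_add_exp_sq (l * X i)).trans
        (add_le_add le_rfl (Real.exp_le_exp.2 h1))) (hp i)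
    linarith
  refine (Finset.sum_le_sum fun i _ => h i).trans_eq ?_
  rw [Finset.sum_add_distrib, ← Finset.mul_sum, ← Finset.sum_mul, hX, hp1]
  ring

/-! ### Finite paths and their expectations -/

section Paths
variable {S A : Type*} [Fintype S] [Fintype A] {R : Finset ℝ}
  (μ : S → A → PMF (S × R)) (π : S → PMF A) (s₀ : S)

/-- The real-valued version of `stepProb`. -/
noncomputable def stepReal (s : S) (y : A × S × R) : ℝ := (stepProb μ π s y).toReal

omit [Fintype S] [Fintype A] in
theorem stepProb_ne_top (s : S) (y : A × S × R) : stepProb μ π s y ≠ ∞ :=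
  ENNReal.mul_ne_top (PMF.apply_ne_top _ _) (PMF.apply_ne_top _ _)

omit [Fintype S] [Fintype A] in
theorem stepReal_nonneg (s : S) (y : A × S × R) : 0 ≤ stepReal μ π s y := ENNReal.toReal_nonneg

omit [Fintype S] [Fintype A] in
theorem stepReal_pos_iff (s : S) (y : A × S × R) :
    0 < stepReal μ π s y ↔ 0 < stepProb μ π s y :=
  ⟨fun h => (ENNReal.toReal_pos_iff.1 h).1,
    fun h => ENNReal.toReal_pos h.ne' (stepProb_ne_top μ π s y)⟩

theorem sum_stepReal (s : S) : ∑ y, stepReal μ π s y = 1 := by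
  unfold stepReal
  rw [← ENNReal.toReal_sum fun y _ => stepProb_ne_top μ π s y, Fintype.sum_prod_type]
  have h1 : ∀ a, ∑ y, stepProb μ π s (a, y) = π s a := by
    intro a
    simp only [stepProb, ← Finset.mul_sum]
    rw [← tsum_fintype (L := .unconditional _), PMF.tsum_coe, mul_one]
  simp only [h1]
  rw [← tsum_fintype (L := .unconditional _), PMF.tsum_coe, ENNReal.toReal_one]

/-- A finite path continued by a constant. -/
def extendPath {Z : Type*} (d : Z) {n : ℕ} (l : Fin n → Z) (t : ℕ) : Z :=
  if h : t < n then l ⟨t, h⟩ else d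

theorem extendPath_of_lt {Z : Type*} (d : Z) {n : ℕ} (l : Fin n → Z) {t : ℕ} (h : t < n) :
    extendPath d l t = l ⟨t, h⟩ :=
  dif_pos h

theorem extendPath_snoc {Z : Type*} (d : Z) {n : ℕ} (l : Fin n → Z) (y : Z) :
    extendPath d (Fin.snoc (α := fun _ => Z) l y) = Function.update (extendPath d l) n y := by
  ext t
  rcases lt_trichotomy t n with h | h | h
  · have h' : t < n + 1 := by omega
    simp [extendPath, Function.update_of_ne h.ne, h, h', Fin.snoc]
  · subst h
    simp [extendPath, Fin.snoc]
  · have h1 : ¬ t < n + 1 := by omega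
    have h2 : ¬ t < n := by omega
    simp [extendPath, Function.update_of_ne h.ne', h1, h2]

/-- The probability of the first `n` observations of the path `y`. -/
noncomputable def pathProb (n : ℕ) (y : ℕ → A × S × R) : ℝ :=
  ∏ t ∈ Finset.range n, stepReal μ π (stateAt s₀ y t) (y t)

/-- The expectation of a function of the first `n` observations. -/
noncomputable def pathExpect (d : A × S × R) (n : ℕ) (F : (ℕ → A × S × R) → ℝ) : ℝ :=
  ∑ l : Fin n → A × S × R, pathProb μ π s₀ n (extendPath d l) * F (extendPath d l)

omit [Fintype S] [Fintype A] in
theorem pathProb_nonneg (n : ℕ) (y : ℕ → A × S × R) : 0 ≤ pathProb μ π s₀ n y :=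
  Finset.prod_nonneg fun _ _ => stepReal_nonneg μ π _ _

omit [Fintype S] [Fintype A] in
theorem stateAt_congr {y y' : ℕ → A × S × R} {t : ℕ} (h : ∀ i < t, y i = y' i) :
    stateAt s₀ y t = stateAt s₀ y' t := by
  cases t with
  | zero => rfl
  | succ t => simp only [stateAt]; rw [h t (Nat.lt_succ_self t)]

omit [Fintype S] [Fintype A] in
theorem pathProb_congr {y y' : ℕ → A × S × R} {n : ℕ} (h : ∀ i < n, y i = y' i) :
    pathProb μ π s₀ n y = pathProb μ π s₀ n y' :=
  Finset.prod_congr rfl fun t ht => by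
    have ht := Finset.mem_range.1 ht
    rw [h t ht, stateAt_congr s₀ fun i hi => h i (hi.trans ht)]

/-- The tower property: the last observation is averaged given the earlier ones. All conditional
expectations are taken through this finite sum. -/
theorem pathExpect_succ (d : A × S × R) (n : ℕ) (F : (ℕ → A × S × R) → ℝ) :
    pathExpect μ π s₀ d (n + 1) F = pathExpect μ π s₀ d n fun y =>
      ∑ y', stepReal μ π (stateAt s₀ y n) y' * F (Function.update y n y') := by
  unfold pathExpect
  rw [← (Fin.snocEquiv fun _ => A × S × R).sum_comp, Fintype.sum_prod_type, Finset.sum_comm]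
  refine Finset.sum_congr rfl fun l _ => ?_
  rw [Finset.mul_sum]
  refine Finset.sum_congr rfl fun y' _ => ?_
  have e : extendPath d ((Fin.snocEquiv fun _ => A × S × R) (y', l)) =
      Function.update (extendPath d l) n y' := extendPath_snoc d l y'
  have hup : ∀ i < n, Function.update (extendPath d l) n y' i = extendPath d l i :=
    fun i hi => Function.update_of_ne hi.ne _ _
  rw [e, pathProb, Finset.prod_range_succ, ← pathProb, pathProb_congr μ π s₀ hup,
    stateAt_congr s₀ hup, Function.update_self]
  ring

theorem pathExpect_mono (d : A × S × R) (n : ℕ) {F G : (ℕ → A × S × R) → ℝ}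
    (h : ∀ y, 0 < pathProb μ π s₀ n y → F y ≤ G y) :
    pathExpect μ π s₀ d n F ≤ pathExpect μ π s₀ d n G := by
  refine Finset.sum_le_sum fun l _ => ?_
  rcases (pathProb_nonneg μ π s₀ n (extendPath d l)).eq_or_lt with h0 | hpos
  · rw [← h0, zero_mul, zero_mul]
  · exact mul_le_mul_of_nonneg_left (h _ hpos) hpos.le

theorem pathExpect_one (d : A × S × R) (n : ℕ) : pathExpect μ π s₀ d n (fun _ => 1) = 1 := by
  induction n with
  | zero => simp [pathExpect, pathProb]
  | succ n ih => rw [pathExpect_succ]; simpa only [mul_one, sum_stepReal] using ih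

theorem pathExpect_add (d : A × S × R) (n : ℕ) (F G : (ℕ → A × S × R) → ℝ) :
    pathExpect μ π s₀ d n (fun y => F y + G y) =
      pathExpect μ π s₀ d n F + pathExpect μ π s₀ d n G := by
  simp [pathExpect, mul_add, Finset.sum_add_distrib]

theorem pathExpect_const_mul (d : A × S × R) (n : ℕ) (c : ℝ) (F : (ℕ → A × S × R) → ℝ) :
    pathExpect μ π s₀ d n (fun y => c * F y) = c * pathExpect μ π s₀ d n F := by
  simp only [pathExpect, Finset.mul_sum]
  exact Finset.sum_congr rfl fun _ _ => by ring

open Classical in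
-- The event is covered by the cylinders of the finite paths compatible with it. Subadditivity needs
-- no measurability of the event, and only the upper bound is required.
theorem measureReal_le_pathExpect {Ω : Type*} [MeasurableSpace Ω] {P : Measure Ω}
    [IsProbabilityMeasure P] {Y : ℕ → Ω → A × S × R} (hY : IsExecution μ π s₀ P Y)
    (d : A × S × R) (n : ℕ) (E : Set (ℕ → A × S × R))
    (hE : ∀ y y' : ℕ → A × S × R, (∀ i < n, y i = y' i) → y ∈ E → y' ∈ E) :
    P.real {ω | (fun t => Y t ω) ∈ E} ≤ pathExpect μ π s₀ d n (fun y => if y ∈ E then 1 else 0) := by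
  let cyl : (Fin n → A × S × R) → Set Ω := fun l => {ω | ∀ t < n, Y t ω = extendPath d l t}
  have hsub : {ω | (fun t => Y t ω) ∈ E} ⊆
      ⋃ l ∈ (Finset.univ.filter fun l : Fin n → A × S × R => extendPath d l ∈ E), cyl l := by
    intro ω hω
    have hag : ∀ t < n, Y t ω = extendPath d (fun i : Fin n => Y i ω) t := fun t ht => by
      simp [extendPath, ht]
    simp only [Set.mem_iUnion, Finset.mem_filter, Finset.mem_univ, true_and, exists_prop]
    exact ⟨fun i : Fin n => Y i ω, hE _ _ hag hω, hag⟩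
  refine (measureReal_mono hsub (measure_ne_top _ _)).trans
    ((measureReal_biUnion_finset_le _ _).trans_eq ?_)
  rw [Finset.sum_filter, pathExpect]
  refine Finset.sum_congr rfl fun l _ => ?_
  split_ifs
  · rw [mul_one, Measure.real, hY.prob_prefix n (extendPath d l), ENNReal.toReal_prod]
    rfl
  · rw [mul_zero]

end Paths

/-! ### Windows along a path -/

section Windows
variable {Z : Type*} {m : ℕ}

/-- The `m + 1` consecutive entries of a path from time `t` on. -/
def window (m : ℕ) (t : ℕ) (y : ℕ → Z) : Fin (m + 1) → Z := fun j => y (t + j)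

/-- Shift a window by one and append an entry. -/
def push (w : Fin (m + 1) → Z) (y : Z) : Fin (m + 1) → Z :=
  Fin.snoc (α := fun _ => Z) (Fin.tail w) y

theorem window_succ (t : ℕ) (y : ℕ → Z) :
    window m (t + 1) y = push (window m t y) (y (t + m + 1)) := by
  ext j
  refine Fin.lastCases ?_ (fun j => ?_) j
  · simp only [window, push, Fin.snoc_last, Fin.val_last]
    congr 1; omega
  · simp only [window, push, Fin.snoc_castSucc, Fin.tail, Fin.val_castSucc, Fin.val_succ]
    congr 1; omega

theorem window_congr {t : ℕ} {y y' : ℕ → Z} (h : ∀ i < t + m + 1, y i = y' i) :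
    window m t y = window m t y' := by
  ext j
  exact h _ (by omega)

/-- Realizing a snake and its successor as windows of one path reduces reasoning about `Fin` indices
to arithmetic of times. -/
theorem exists_window_eq_push (w : Fin (m + 1) → Z) (y : Z) :
    ∃ u : ℕ → Z, window m 0 u = w ∧ window m 1 u = push w y ∧ u (m + 1) = y := by
  refine ⟨extendPath y w, ?_, ?_, by simp [extendPath]⟩
  · ext j; rw [window, zero_add, extendPath_of_lt y w j.isLt]
  · have hw : window m 0 (extendPath y w) = w := by
      ext j; rw [window, zero_add, extendPath_of_lt y w j.isLt]
    rw [window_succ, hw]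
    congr 1
    simp [extendPath]

end Windows

/-! ### The snake chain: closedness, irreducibility, Poisson equation -/

section Snake
variable {S A : Type*} [Fintype S] [DecidableEq S] [Fintype A] [DecidableEq A] {R : Finset ℝ}
  (μ : S → A → PMF (S × R)) (π : S → PMF A) (s₀ : S) {m : ℕ}

omit [Fintype S] [DecidableEq S] [Fintype A] [DecidableEq A] in
theorem pairProb_pos_iff (s : S) (x : A × S) :
    0 < pairProb μ π s x ↔ ∃ r : R, 0 < stepProb μ π s (x.1, x.2, r) := by
  unfold pairProb
  rw [pos_iff_ne_zero, Ne, Finset.sum_eq_zero_iff]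
  simp [pos_iff_ne_zero]

theorem mem_pairSpace_of_stepProb_pos {x : A × S} (hx : x ∈ pairSpace μ π s₀) {y : A × S × R}
    (hy : 0 < stepProb μ π x.2 y) : (y.1, y.2.1) ∈ pairSpace μ π s₀ := by
  obtain ⟨x₁, h₁, n, hn⟩ := hx
  refine ⟨x₁, h₁, n + 1, ?_⟩
  rw [pow_succ, Matrix.mul_apply, pos_iff_ne_zero, Ne, Finset.sum_eq_zero_iff]
  intro h0
  have hp : 0 < pairProb μ π x.2 (y.1, y.2.1) := (pairProb_pos_iff μ π _ _).2 ⟨y.2.2, hy⟩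
  exact (mul_ne_zero hn.ne' hp.ne') (h0 x (Finset.mem_univ x))

theorem mem_pairSpace_of_mem_obsSpace {y : A × S × R} (hy : y ∈ obsSpace μ π s₀) :
    (y.1, y.2.1) ∈ pairSpace μ π s₀ := by
  obtain ⟨x, hx, hxy⟩ := hy
  exact mem_pairSpace_of_stepProb_pos μ π s₀ hx hxy

theorem mem_obsSpace_of_stepProb_pos {y y' : A × S × R} (hy : y ∈ obsSpace μ π s₀)
    (h : 0 < stepProb μ π y.2.1 y') : y' ∈ obsSpace μ π s₀ :=
  ⟨_, mem_pairSpace_of_mem_obsSpace μ π s₀ hy, h⟩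

theorem window_mem_snakeSpace_iff (t : ℕ) (u : ℕ → A × S × R) :
    window m t u ∈ snakeSpace μ π s₀ m ↔
      u t ∈ obsSpace μ π s₀ ∧ ∀ j < m, 0 < stepProb μ π (u (t + j)).2.1 (u (t + j + 1)) :=
  ⟨fun h => ⟨h.1, fun j hj => h.2 ⟨j, hj⟩⟩, fun h => ⟨h.1, fun j => h.2 j j.isLt⟩⟩

theorem mem_obsSpace_of_mem_snakeSpace {w : Fin (m + 1) → A × S × R}
    (hw : w ∈ snakeSpace μ π s₀ m) (j : Fin (m + 1)) : w j ∈ obsSpace μ π s₀ := by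
  induction j using Fin.induction with
  | zero => exact hw.1
  | succ j ih => exact mem_obsSpace_of_stepProb_pos μ π s₀ ih (hw.2 j)

theorem push_mem_snakeSpace {w : Fin (m + 1) → A × S × R} (hw : w ∈ snakeSpace μ π s₀ m)
    {y : A × S × R} (hy : 0 < stepProb μ π (w (Fin.last m)).2.1 y) :
    push w y ∈ snakeSpace μ π s₀ m := by
  obtain ⟨u, rfl, h1, h2⟩ := exists_window_eq_push w y
  have hlast : window m 0 u (Fin.last m) = u m := by simp [window]
  rw [hlast, ← h2] at hy
  rw [← h1, window_mem_snakeSpace_iff]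
  obtain ⟨h3, h4⟩ := (window_mem_snakeSpace_iff μ π s₀ 0 u).1 hw
  simp only [zero_add] at h4
  have h5 : ∀ j < m + 1, 0 < stepProb μ π (u j).2.1 (u (j + 1)) := by
    intro j hj
    rcases (Nat.lt_succ_iff.1 hj).eq_or_lt with rfl | hj
    · exact hy
    · exact h4 j hj
  exact ⟨mem_obsSpace_of_stepProb_pos μ π s₀ h3 (h5 0 (Nat.succ_pos m)),
    fun j hj => by rw [Nat.add_comm 1 j]; exact h5 (j + 1) (by omega)⟩

omit [Fintype S] [Fintype A] [DecidableEq S] [DecidableEq A] in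
theorem snakeProb_push (w : Fin (m + 1) → A × S × R) (y : A × S × R) :
    snakeProb μ π w (push w y) = stepProb μ π (w (Fin.last m)).2.1 y := by
  unfold snakeProb push
  rw [if_pos fun j => by rw [Fin.snoc_castSucc]; rfl, Fin.snoc_last]

omit [Fintype S] [Fintype A] [DecidableEq S] [DecidableEq A] in
theorem eq_push_of_snakeProb_ne_zero {w w' : Fin (m + 1) → A × S × R}
    (h : snakeProb μ π w w' ≠ 0) : w' = push w (w' (Fin.last m)) := by
  have h1 : ∀ j : Fin m, w' j.castSucc = w j.succ := by
    by_contra hn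
    exact h (by unfold snakeProb; rw [if_neg hn])
  ext1 j
  refine Fin.lastCases ?_ (fun j => ?_) j
  · simp [push]
  · rw [push, Fin.snoc_castSucc, h1 j]; rfl

omit [DecidableEq S] [DecidableEq A] in
-- The row of w is supported on the snakes `push w y`, and these are distinct for distinct y.
theorem sum_snakeProb_mul (w : Fin (m + 1) → A × S × R) (g : (Fin (m + 1) → A × S × R) → ℝ) :
    ∑ w', (snakeProb μ π w w').toReal * g w' =
      ∑ y, stepReal μ π (w (Fin.last m)).2.1 y * g (push w y) := by
  classical
  symm
  have hinj : Function.Injective (push w) := fun y y' h => by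
    have := congrFun h (Fin.last m)
    simpa [push] using this
  have : ∀ y, stepReal μ π (w (Fin.last m)).2.1 y * g (push w y) =
      (fun w' => (snakeProb μ π w w').toReal * g w') (push w y) := fun y => by
    simp only [snakeProb_push, stepReal]
  simp only [this]
  rw [← Finset.sum_image (s := Finset.univ) (g := push w)
    (f := fun w' => (snakeProb μ π w w').toReal * g w') fun x _ y _ h => hinj h]
  refine Finset.sum_subset (Finset.subset_univ _) fun w' _ hw' => ?_
  by_cases h : snakeProb μ π w w' = 0
  · simp [h]
  · exact absurd (Finset.mem_image.2 ⟨_, Finset.mem_univ _,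
      (eq_push_of_snakeProb_ne_zero μ π h).symm⟩) hw'

/-- A snake can be reached from another by successive observations of positive probability. -/
def SnakeReach (w w' : Fin (m + 1) → A × S × R) : Prop :=
  Relation.ReflTransGen (fun a b => 0 < (snakeProb μ π a b).toReal) w w'

omit [Fintype S] [Fintype A] [DecidableEq S] [DecidableEq A] in
theorem snakeProb_push_toReal_pos {w : Fin (m + 1) → A × S × R} {y : A × S × R}
    (hy : 0 < stepProb μ π (w (Fin.last m)).2.1 y) :
    0 < (snakeProb μ π w (push w y)).toReal := by
  rw [snakeProb_push]
  exact (stepReal_pos_iff μ π _ _).2 hy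

omit [Fintype S] [Fintype A] [DecidableEq S] [DecidableEq A] in
theorem snakeReach_window (u : ℕ → A × S × R) (T : ℕ)
    (h : ∀ j < T + m, 0 < stepProb μ π (u j).2.1 (u (j + 1))) :
    SnakeReach μ π (window m 0 u) (window m T u) := by
  induction T with
  | zero => exact Relation.ReflTransGen.refl
  | succ T ih =>
    refine (ih fun j hj => h j (by omega)).tail ?_
    rw [window_succ]
    exact snakeProb_push_toReal_pos μ π (h (T + m) (by omega))

theorem exists_snakeReach_of_pow_pos {w : Fin (m + 1) → A × S × R} {n : ℕ} {x : A × S}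
    (hx : 0 < (pairMatrix μ π ^ n) ((w (Fin.last m)).1, (w (Fin.last m)).2.1) x) :
    ∃ w', SnakeReach μ π w w' ∧ ((w' (Fin.last m)).1, (w' (Fin.last m)).2.1) = x := by
  induction n generalizing x with
  | zero =>
    refine ⟨w, Relation.ReflTransGen.refl, ?_⟩
    by_contra hne
    rw [pow_zero, Matrix.one_apply_ne hne] at hx
    exact hx.ne rfl
  | succ n ih =>
    rw [pow_succ, Matrix.mul_apply, pos_iff_ne_zero, Ne, Finset.sum_eq_zero_iff] at hx
    push Not at hx
    obtain ⟨z, -, hz⟩ := hx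
    obtain ⟨hz1, hz2⟩ := mul_ne_zero_iff.1 hz
    obtain ⟨w', hw', rfl⟩ := ih (pos_iff_ne_zero.2 hz1)
    obtain ⟨r, hr⟩ := (pairProb_pos_iff μ π _ x).1 (pos_iff_ne_zero.2 hz2)
    refine ⟨push w' (x.1, x.2, r), hw'.tail (snakeProb_push_toReal_pos μ π hr), ?_⟩
    simp [push]

/-- The first entry of w' follows some reachable pair x with positive probability. Irreducibility of
the pair chain leads from the last pair of w to x, and appending the m + 1 entries of w' then
overwrites the whole window. -/
theorem snakeReach_of_irreducible (hIR : IrreducibleOn (pairMatrix μ π) (pairSpace μ π s₀))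
    {w w' : Fin (m + 1) → A × S × R} (hw : w ∈ snakeSpace μ π s₀ m)
    (hw' : w' ∈ snakeSpace μ π s₀ m) : SnakeReach μ π w w' := by
  obtain ⟨x, hx, hxw⟩ := hw'.1
  obtain ⟨n, -, hn⟩ := hIR _ (mem_pairSpace_of_mem_obsSpace μ π s₀
    (mem_obsSpace_of_mem_snakeSpace μ π s₀ hw (Fin.last m))) x hx
  obtain ⟨w₁, hw₁, hlast⟩ := exists_snakeReach_of_pow_pos μ π hn
  refine hw₁.trans ?_
  have hw₁C : w₁ ∈ snakeSpace μ π s₀ m := by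
    clear hlast
    induction hw₁ with
    | refl => exact hw
    | tail _ hbc ih =>
      have hne := (ENNReal.toReal_pos_iff.1 hbc).1
      rw [eq_push_of_snakeProb_ne_zero μ π hne.ne', snakeProb_push] at hne
      rw [eq_push_of_snakeProb_ne_zero μ π (ENNReal.toReal_pos_iff.1 hbc).1.ne']
      exact push_mem_snakeSpace μ π s₀ ih hne
  -- The concatenation of w₁ and w'; its windows at times 0 and m + 1 are w₁ and w'.
  let u : ℕ → A × S × R := fun t => if t < m + 1 then extendPath (w' 0) w₁ t
    else extendPath (w' 0) w' (t - (m + 1))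
  have hu1 : ∀ t (h : t < m + 1), u t = w₁ ⟨t, h⟩ := fun t h => by
    simp only [u, if_pos h, extendPath_of_lt _ _ h]
  have hu2 : ∀ t (h : t < m + 1), u (m + 1 + t) = w' ⟨t, h⟩ := fun t h => by
    have h1 : ¬ m + 1 + t < m + 1 := by omega
    simp only [u, if_neg h1, Nat.add_sub_cancel_left, extendPath_of_lt _ _ h]
  have h1 : window m 0 u = w₁ := by
    ext1 j; simp only [window, zero_add]; exact hu1 j j.isLt
  have h2 : window m (m + 1) u = w' := by
    ext1 j; exact hu2 j j.isLt
  have hstep : ∀ j < m + 1 + m, 0 < stepProb μ π (u j).2.1 (u (j + 1)) := by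
    intro j hj
    rcases lt_trichotomy j m with h | h | h
    · rw [hu1 j (by omega), hu1 (j + 1) (by omega)]
      exact hw₁C.2 ⟨j, h⟩
    · subst h
      have e1 : u j = w₁ (Fin.last j) := hu1 j (by omega)
      have e2 : u (j + 1) = w' 0 := hu2 0 (by omega)
      rw [e1, e2]
      have : (w₁ (Fin.last j)).2.1 = x.2 := congrArg Prod.snd hlast
      rw [this]
      exact hxw
    · obtain ⟨i, rfl⟩ : ∃ i, j = m + 1 + i := ⟨j - (m + 1), by omega⟩
      rw [hu2 i (by omega), add_assoc (m + 1) i 1, hu2 (i + 1) (by omega)]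
      exact hw'.2 ⟨i, by omega⟩
  have := snakeReach_window μ π u (m + 1) hstep
  rwa [h1, h2] at this

/-- The Poisson equation for functions of the snake chain. -/
theorem exists_snake_poisson (hIR : IrreducibleOn (pairMatrix μ π) (pairSpace μ π s₀))
    (ν : PMF (Fin (m + 1) → A × S × R)) (hν : IsStationarySnake μ π s₀ ν)
    (f : (Fin (m + 1) → A × S × R) → ℝ) :
    ∃ g : (Fin (m + 1) → A × S × R) → ℝ, ∀ w ∈ snakeSpace μ π s₀ m,
      g w - ∑ y, stepReal μ π (w (Fin.last m)).2.1 y * g (push w y) =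
        f w - ∑ w, (ν w).toReal * f w := by
  have hfin : ∀ w w', snakeProb μ π (m := m) w w' ≠ ∞ := fun w w' => by
    unfold snakeProb; split_ifs
    · exact stepProb_ne_top μ π _ _
    · exact ENNReal.zero_ne_top
  obtain ⟨g, hg⟩ := exists_poisson (fun w w' => (snakeProb μ π w w').toReal)
    (fun _ _ => ENNReal.toReal_nonneg) (C := snakeSpace μ π s₀ m)
    (fun w hw w' hww' => by
      have hne := (ENNReal.toReal_pos_iff.1 hww').1
      rw [eq_push_of_snakeProb_ne_zero μ π hne.ne', snakeProb_push] at hne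
      rw [eq_push_of_snakeProb_ne_zero μ π (ENNReal.toReal_pos_iff.1 hww').1.ne']
      exact push_mem_snakeSpace μ π s₀ hw hne)
    (fun w _ => by
      have := sum_snakeProb_mul μ π w fun _ => 1
      simpa only [mul_one, sum_stepReal] using this)
    (fun w hw w' hw' => snakeReach_of_irreducible μ π s₀ hIR hw hw')
    (fun w => (ν w).toReal)
    (fun w hw => by
      have : ν w = 0 := by
        by_contra h
        exact hw (hν.1 ((PMF.mem_support_iff _ _).2 h))
      simp [this])
    (by
      rw [← ENNReal.toReal_sum fun w _ => PMF.apply_ne_top _ _,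
        ← tsum_fintype (L := .unconditional _), PMF.tsum_coe, ENNReal.toReal_one])
    (fun w' => by
      show (ν w').toReal = _
      rw [hν.2 w', tsum_fintype, ENNReal.toReal_sum fun w _ =>
        ENNReal.mul_ne_top (PMF.apply_ne_top _ _) (hfin w w')]
      simp only [ENNReal.toReal_mul]) f
  refine ⟨g, fun w hw => ?_⟩
  rw [← sum_snakeProb_mul]
  exact hg w hw

/-- Time 0 is excluded because the first observation starts from s₀, which need not be the state of
any reachable pair. -/
theorem window_mem_snakeSpace_of_pathProb_pos {n : ℕ} {y : ℕ → A × S × R}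
    (hy : 0 < pathProb μ π s₀ n y) {t : ℕ} (ht : 1 ≤ t) (htn : t + m < n) :
    window m t y ∈ snakeSpace μ π s₀ m := by
  have hpos : ∀ i < n, 0 < stepProb μ π (stateAt s₀ y i) (y i) := by
    intro i hi
    rw [← stepReal_pos_iff]
    refine lt_of_le_of_ne (stepReal_nonneg μ π _ _) fun h0 => hy.ne' ?_
    exact Finset.prod_eq_zero (Finset.mem_range.2 hi) h0.symm
  have hpair : ((y 0).1, (y 0).2.1) ∈ pairSpace μ π s₀ :=
    ⟨((y 0).1, (y 0).2.1), (pairProb_pos_iff μ π s₀ ((y 0).1, (y 0).2.1)).2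
      ⟨(y 0).2.2, hpos 0 (by omega)⟩, 0, by simp⟩
  have hobs : ∀ i, i + 1 < n → y (i + 1) ∈ obsSpace μ π s₀ := by
    intro i
    induction i with
    | zero => exact fun hi => ⟨_, hpair, hpos 1 hi⟩
    | succ i ih =>
      exact fun hi => mem_obsSpace_of_stepProb_pos μ π s₀ (ih (by omega)) (hpos (i + 2) hi)
  rw [window_mem_snakeSpace_iff]
  obtain ⟨i, rfl⟩ : ∃ i, t = i + 1 := ⟨t - 1, by omega⟩
  exact ⟨hobs i (by omega), fun j hj => hpos (i + 1 + j + 1) (by omega)⟩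

end Snake

/-! ### Martingale concentration -/

section Concentration
variable {S A : Type*} [Fintype S] [Fintype A] {R : Finset ℝ}
  (μ : S → A → PMF (S × R)) (π : S → PMF A) (s₀ : S) {m : ℕ}

/-- The expected value of `g` at the snake that follows `w`. -/
noncomputable def snakeMean (g : (Fin (m + 1) → A × S × R) → ℝ) (w : Fin (m + 1) → A × S × R) : ℝ :=
  ∑ y, stepReal μ π (w (Fin.last m)).2.1 y * g (push w y)

/-- The martingale of the innovations of `g` along the snake chain. -/
noncomputable def snakeMartingale (g : (Fin (m + 1) → A × S × R) → ℝ) (T : ℕ)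
    (y : ℕ → A × S × R) : ℝ :=
  ∑ t ∈ Finset.range T, (g (window m (t + 1) y) - snakeMean μ π g (window m t y))

theorem snakeMartingale_update (g : (Fin (m + 1) → A × S × R) → ℝ) (T : ℕ)
    (y : ℕ → A × S × R) (y' : A × S × R) :
    snakeMartingale μ π g (T + 1) (Function.update y (T + m + 1) y') =
      snakeMartingale μ π g T y +
        (g (push (window m T y) y') - snakeMean μ π g (window m T y)) := by
  have hag : ∀ i < T + m + 1, Function.update y (T + m + 1) y' i = y i :=
    fun i hi => Function.update_of_ne hi.ne _ _
  rw [snakeMartingale, Finset.sum_range_succ, window_succ T, window_congr hag,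
    Function.update_self, snakeMartingale]
  congr 1
  refine Finset.sum_congr rfl fun t ht => ?_
  have ht := Finset.mem_range.1 ht
  rw [window_congr fun i hi => hag i (by omega : i < T + m + 1),
    window_congr (t := t) fun i hi => hag i (by omega : i < T + m + 1)]

theorem abs_snakeMean_le {g : (Fin (m + 1) → A × S × R) → ℝ} {G : ℝ} (hG : ∀ w, |g w| ≤ G)
    (w : Fin (m + 1) → A × S × R) : |snakeMean μ π g w| ≤ G := by
  refine (Finset.abs_sum_le_sum_abs _ _).trans ?_
  have h : ∀ y ∈ Finset.univ, |stepReal μ π (w (Fin.last m)).2.1 y * g (push w y)| ≤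
      stepReal μ π (w (Fin.last m)).2.1 y * G := fun y _ => by
    rw [abs_mul, abs_of_nonneg (stepReal_nonneg μ π _ _)]
    exact mul_le_mul_of_nonneg_left (hG _) (stepReal_nonneg μ π _ _)
  refine (Finset.sum_le_sum h).trans_eq ?_
  rw [← Finset.sum_mul, sum_stepReal, one_mul]

/-- Each innovation is centred given the past and bounded by 2G, so each step multiplies the
exponential moment by at most exp(l²(2G)²). The window at time T ends at time T + m, hence the T + m
+ 1 observations. -/
theorem pathExpect_exp_snakeMartingale_le (d : A × S × R) {g : (Fin (m + 1) → A × S × R) → ℝ}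
    {G : ℝ} (hG : ∀ w, |g w| ≤ G) (l : ℝ) (T : ℕ) :
    pathExpect μ π s₀ d (T + m + 1) (fun y => Real.exp (l * snakeMartingale μ π g T y)) ≤
      Real.exp (T * (l ^ 2 * (2 * G) ^ 2)) := by
  induction T with
  | zero => simp [snakeMartingale, pathExpect_one]
  | succ T ih =>
    have hn : T + 1 + m + 1 = (T + m + 1) + 1 := by omega
    rw [hn, pathExpect_succ]
    have hstep : ∀ y : ℕ → A × S × R,
        ∑ y', stepReal μ π (stateAt s₀ y (T + m + 1)) y' *
          Real.exp (l * snakeMartingale μ π g (T + 1) (Function.update y (T + m + 1) y')) ≤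
        Real.exp (l ^ 2 * (2 * G) ^ 2) * Real.exp (l * snakeMartingale μ π g T y) := by
      intro y
      have hs : stateAt s₀ y (T + m + 1) = (window m T y (Fin.last m)).2.1 := rfl
      have hb := sum_mul_exp_le (stepReal μ π (window m T y (Fin.last m)).2.1)
        (fun y' => g (push (window m T y) y') - snakeMean μ π g (window m T y))
        (fun y' => stepReal_nonneg μ π _ _) (sum_stepReal μ π _)
        (by
          simp only [mul_sub, Finset.sum_sub_distrib, ← Finset.sum_mul, sum_stepReal, one_mul]
          exact sub_self _)
        (K := 2 * G)
        (fun y' => (abs_sub _ _).trans (by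
          linarith [hG (push (window m T y) y'), abs_snakeMean_le μ π hG (window m T y)])) l
      refine le_trans (le_of_eq ?_) (mul_le_mul_of_nonneg_right hb (Real.exp_pos _).le)
      rw [Finset.sum_mul]
      refine Finset.sum_congr rfl fun y' _ => ?_
      rw [hs, snakeMartingale_update, mul_add, Real.exp_add]
      ring
    refine (pathExpect_mono μ π s₀ d _ fun y _ => hstep y).trans ?_
    rw [pathExpect_const_mul]
    refine (mul_le_mul_of_nonneg_left ih (Real.exp_pos _).le).trans_eq ?_
    rw [← Real.exp_add]
    congr 1
    push_cast
    ring

variable [DecidableEq S] [DecidableEq A]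

/-- Sub-Gaussian concentration of the empirical averages of a function of the snake chain. -/
theorem exists_snake_concentration (hIR : IrreducibleOn (pairMatrix μ π) (pairSpace μ π s₀))
    (ν : PMF (Fin (m + 1) → A × S × R)) (hν : IsStationarySnake μ π s₀ ν)
    {Ω : Type*} [MeasurableSpace Ω] (P : Measure Ω) [IsProbabilityMeasure P]
    (Y : ℕ → Ω → A × S × R) (hY : IsExecution μ π s₀ P Y)
    (f : (Fin (m + 1) → A × S × R) → ℝ) :
    ∃ D c : ℝ, 0 ≤ D ∧ 0 < c ∧ ∀ (T n : ℕ) (t : ℝ), T ≤ n → 1 ≤ n → 0 ≤ t →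
      P.real {ω | D + t < |∑ j ∈ Finset.range T,
        (f (window m j fun i => Y i ω) - ∑ w, (ν w).toReal * f w)|} ≤
        2 * Real.exp (-(t ^ 2 / (c * n))) := by
  obtain ⟨g, hg⟩ := exists_snake_poisson μ π s₀ hIR ν hν f
  set q := ∑ w, (ν w).toReal * f w with hq
  set G : ℝ := ∑ w, |g w| + 1 with hGdef
  have hG0 : 0 < G := add_pos_of_nonneg_of_pos (Finset.sum_nonneg fun _ _ => abs_nonneg _) one_pos
  have hG : ∀ w, |g w| ≤ G := fun w => by
    have := Finset.single_le_sum (f := fun w => |g w|) (fun _ _ => abs_nonneg _)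
      (Finset.mem_univ w)
    linarith
  -- The defect in the Poisson equation. Along a path of positive probability only the window at
  -- time 0 can leave the snake space, so the defects add up to at most D₁.
  let r : (Fin (m + 1) → A × S × R) → ℝ := fun w => f w - q - (g w - snakeMean μ π g w)
  have hr : ∀ w ∈ snakeSpace μ π s₀ m, r w = 0 := fun w hw => by
    have h1 : g w - snakeMean μ π g w = f w - q := hg w hw
    simp only [r, h1, sub_self]
  set D₁ : ℝ := ∑ w, |r w| with hD₁
  have hD₁0 : 0 ≤ D₁ := Finset.sum_nonneg fun _ _ => abs_nonneg _
  have hrD : ∀ w, |r w| ≤ D₁ := fun w =>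
    Finset.single_le_sum (f := fun w => |r w|) (fun _ _ => abs_nonneg _) (Finset.mem_univ w)
  -- A sample point supplies the observation `Y 0 ω₀` by which finite paths are continued.
  obtain ⟨ω₀⟩ : Nonempty Ω := nonempty_of_isProbabilityMeasure P
  refine ⟨D₁ + 2 * G, 4 * (2 * G) ^ 2, by positivity, by positivity, fun T n t hT hn ht => ?_⟩
  set E : Set (ℕ → A × S × R) :=
    {y | D₁ + 2 * G + t < |∑ j ∈ Finset.range T, (f (window m j y) - q)|} with hE
  have hEdep : ∀ y y' : ℕ → A × S × R, (∀ i < T + m + 1, y i = y' i) → y ∈ E → y' ∈ E := by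
    intro y y' hag hy
    have : ∑ j ∈ Finset.range T, (f (window m j y') - q) =
        ∑ j ∈ Finset.range T, (f (window m j y) - q) :=
      Finset.sum_congr rfl fun j hj => by
        have hj := Finset.mem_range.1 hj
        rw [window_congr fun i hi => (hag i (by omega : i < T + m + 1)).symm]
    rw [hE, Set.mem_ofPred_eq, this]
    exact hy
  have hkey : ∀ y, 0 < pathProb μ π s₀ (T + m + 1) y → y ∈ E →
      t ≤ |snakeMartingale μ π g T y| := by
    intro y hy hyE
    have hsplit : ∑ j ∈ Finset.range T, (f (window m j y) - q) =
        ∑ j ∈ Finset.range T, r (window m j y) +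
          (snakeMartingale μ π g T y + (g (window m 0 y) - g (window m T y))) := by
      rw [← Finset.sum_range_sub' (fun j => g (window m j y)), snakeMartingale,
        ← Finset.sum_add_distrib, ← Finset.sum_add_distrib]
      exact Finset.sum_congr rfl fun j _ => by simp only [r]; ring
    have hrs : |∑ j ∈ Finset.range T, r (window m j y)| ≤ D₁ := by
      cases T with
      | zero => simpa using hD₁0
      | succ T =>
        rw [Finset.sum_range_succ', Finset.sum_eq_zero, zero_add]
        · exact hrD _
        · intro j hj
          have hj := Finset.mem_range.1 hj
          exact hr _ (window_mem_snakeSpace_of_pathProb_pos μ π s₀ hy (by omega) (by omega))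
    have h1 : D₁ + 2 * G + t < |∑ j ∈ Finset.range T, (f (window m j y) - q)| := hyE
    rw [hsplit] at h1
    have h2 := abs_add_le (∑ j ∈ Finset.range T, r (window m j y))
      (snakeMartingale μ π g T y + (g (window m 0 y) - g (window m T y)))
    have h3 := abs_add_le (snakeMartingale μ π g T y) (g (window m 0 y) - g (window m T y))
    have h4 := abs_sub (g (window m 0 y)) (g (window m T y))
    linarith [hG (window m 0 y), hG (window m T y)]
  have hn0 : (0 : ℝ) < n := by exact_mod_cast hn
  -- The minimizer of -lt + nl²(2G)², with minimum -t² / (4(2G)²n).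
  set l : ℝ := t / (2 * n * (2 * G) ^ 2) with hl
  have hl0 : 0 ≤ l := by positivity
  have hind : ∀ y, 0 < pathProb μ π s₀ (T + m + 1) y →
      (open Classical in if y ∈ E then (1 : ℝ) else 0) ≤
        Real.exp (-(l * t)) * (Real.exp (l * snakeMartingale μ π g T y) +
          Real.exp (-l * snakeMartingale μ π g T y)) := by
    intro y hy
    split_ifs with hyE
    · rw [mul_add, ← Real.exp_add, ← Real.exp_add]
      rcases le_abs.1 (hkey y hy hyE) with h | h
      · have h1 := mul_le_mul_of_nonneg_left h hl0
        have h2 : 1 ≤ Real.exp (-(l * t) + l * snakeMartingale μ π g T y) :=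
          Real.one_le_exp (by linarith)
        linarith [Real.exp_pos (-(l * t) + -l * snakeMartingale μ π g T y)]
      · have h1 := mul_le_mul_of_nonneg_left h hl0
        have h2 : 1 ≤ Real.exp (-(l * t) + -l * snakeMartingale μ π g T y) :=
          Real.one_le_exp (by linarith)
        linarith [Real.exp_pos (-(l * t) + l * snakeMartingale μ π g T y)]
    · positivity
  refine (measureReal_le_pathExpect μ π s₀ hY (Y 0 ω₀) (T + m + 1) E hEdep).trans
    ((pathExpect_mono μ π s₀ _ _ hind).trans ?_)
  rw [pathExpect_const_mul, pathExpect_add]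
  have h1 := pathExpect_exp_snakeMartingale_le μ π s₀ (Y 0 ω₀) hG l T
  have h2 := pathExpect_exp_snakeMartingale_le μ π s₀ (Y 0 ω₀) hG (-l) T
  rw [neg_sq] at h2
  have h3 : Real.exp (T * (l ^ 2 * (2 * G) ^ 2)) ≤ Real.exp (n * (l ^ 2 * (2 * G) ^ 2)) :=
    Real.exp_le_exp.2 (mul_le_mul_of_nonneg_right (by exact_mod_cast hT) (by positivity))
  refine (mul_le_mul_of_nonneg_left (add_le_add (h1.trans h3) (h2.trans h3))
    (Real.exp_pos _).le).trans_eq ?_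
  rw [← two_mul, mul_left_comm, ← Real.exp_add]
  congr 2
  rw [hl]
  field_simp
  ring

end Concentration

/-! ### Buckets as functionals of the snake chain -/

open Classical in
/-- The indicator of the snakes that put the state `x` into the bucket of `z` and `a`. -/
noncomputable def bucketIndicator {S A : Type*} {R : Finset ℝ} {m : ℕ} (z : ℝ) (a : A) (x : S)
    (w : Fin (m + 1) → A × S × R) : ℝ :=
  if (w 0).2.1 = x ∧ snakeReturn w = z ∧ (w 1).1 = a then 1 else 0

/-- The stationary probability of the snakes that put `x` into the bucket of `z` and `a`. -/
noncomputable def bucketMean {S A : Type*} [Fintype S] [Fintype A] {R : Finset ℝ} {m : ℕ}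
    (ν : PMF (Fin (m + 1) → A × S × R)) (z : ℝ) (a : A) (x : S) : ℝ :=
  ∑ w, (ν w).toReal * bucketIndicator z a x w

open Classical in
theorem PMF.toReal_toOuterMeasure_apply {X : Type*} [Fintype X] (ν : PMF X) (s : Set X) :
    (ν.toOuterMeasure s).toReal = ∑ x, if x ∈ s then (ν x).toReal else 0 := by
  rw [PMF.toOuterMeasure_apply, tsum_fintype, ENNReal.toReal_sum]
  · exact Finset.sum_congr rfl fun x _ => by
      by_cases h : x ∈ s <;> simp [h]
  · intro x _
    by_cases h : x ∈ s <;> simp [h, PMF.apply_ne_top]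

section Bucket
variable {S A : Type*} {R : Finset ℝ} {m : ℕ}

open Classical in
theorem countWeight_bucket [DecidableEq S] (s₀ : S) (y : ℕ → A × S × R) (z : ℝ) (a : A) (n : ℕ)
    (x : S) : countWeight (bucket s₀ m y z a n) x = ∑ i ∈ Finset.range n,
      if stateAt s₀ y i = x ∧ (∑ j ∈ Finset.range m, ((y (i + j)).2.2 : ℝ)) = z ∧ (y i).1 = a
      then (1 : ℝ) else 0 := by
  induction n with
  | zero => simp [bucket, countWeight]
  | succ n ih =>
    rw [Finset.sum_range_succ, ← ih]
    have : bucket s₀ m y z a (n + 1) = bucket s₀ m y z a n ++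
        if (∑ j ∈ Finset.range m, ((y (n + j)).2.2 : ℝ)) = z ∧ (y n).1 = a
        then [stateAt s₀ y n] else [] := by
      unfold bucket
      rw [List.range_succ, List.filter_append, List.map_append]
      congr 1
      split_ifs with h <;> simp [h]
    rw [this]
    by_cases h : (∑ j ∈ Finset.range m, ((y (n + j)).2.2 : ℝ)) = z ∧ (y n).1 = a
    · by_cases hx : stateAt s₀ y n = x
      · rw [if_pos h, if_pos ⟨hx, h⟩, hx]
        simp [countWeight]
      · rw [if_pos h, if_neg fun H => hx H.1]
        simp [countWeight, List.count_cons_of_ne hx]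
    · rw [if_neg h, if_neg fun H => h H.2]
      simp

theorem bucketIndicator_window [DecidableEq S] (hm : 1 ≤ m) (s₀ : S) (y : ℕ → A × S × R) (z : ℝ)
    (a : A) (x : S) (i : ℕ) : bucketIndicator z a x (window m i y) = open Classical in
      if stateAt s₀ y (i + 1) = x ∧
        (∑ j ∈ Finset.range m, ((y (i + 1 + j)).2.2 : ℝ)) = z ∧ (y (i + 1)).1 = a
      then (1 : ℝ) else 0 := by
  -- For m = 0 the index 1 of `Fin (m + 1)` would wrap round to 0.
  obtain ⟨m, rfl⟩ : ∃ m', m = m' + 1 := ⟨m - 1, by omega⟩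
  have h1 : snakeReturn (window (m + 1) i y) =
      ∑ j ∈ Finset.range (m + 1), ((y (i + 1 + j)).2.2 : ℝ) := by
    rw [snakeReturn, ← Fin.sum_univ_eq_sum_range fun j => ((y (i + 1 + j)).2.2 : ℝ)]
    refine Finset.sum_congr rfl fun j _ => ?_
    rw [window, Fin.val_succ, show i + (j.val + 1) = i + 1 + j.val by omega]
  have h2 : window (m + 1) i y 1 = y (i + 1) := by simp [window]
  have h0 : (window (m + 1) i y 0).2.1 = stateAt s₀ y (i + 1) := by simp [window, stateAt]
  rw [bucketIndicator, h1, h2, h0]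
  congr!

/-- The window at time i decides on the state at time i + 1, so T windows account for T + 1 states
except s₀. That one state costs at most 1. -/
theorem abs_countWeight_bucket_sub_le [DecidableEq S] (hm : 1 ≤ m) (s₀ : S)
    (y : ℕ → A × S × R) (z : ℝ) (a : A) (T : ℕ) (x : S) {q : ℝ} (hq : 0 ≤ q ∧ q ≤ 1) :
    |countWeight (bucket s₀ m y z a (T + 1)) x - ((T + 1 : ℕ) : ℝ) * q| ≤
      |∑ i ∈ Finset.range T, (bucketIndicator z a x (window m i y) - q)| + 1 := by
  classical
  rw [countWeight_bucket, Finset.sum_range_succ']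
  simp only [bucketIndicator_window hm s₀, Finset.sum_sub_distrib, Finset.sum_const,
    Finset.card_range, nsmul_eq_mul]
  have key : ∀ M b : ℝ, 0 ≤ b → b ≤ 1 →
      |M + b - ((T + 1 : ℕ) : ℝ) * q| ≤ |M - T * q| + 1 := by
    intro M b hb0 hb1
    have e : M + b - ((T + 1 : ℕ) : ℝ) * q = (M - T * q) + (b - q) := by push_cast; ring
    rw [e]
    exact (abs_add_le _ _).trans
      (add_le_add le_rfl (abs_sub_le_iff.2 ⟨by linarith, by linarith⟩))
  refine le_trans (key _ _ ?_ ?_) (le_of_eq ?_)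
  · split_ifs <;> norm_num
  · split_ifs <;> norm_num
  · congr!

variable [Fintype S] [Fintype A]

theorem bucketMean_eq (ν : PMF (Fin (m + 1) → A × S × R)) (z : ℝ) (a : A) (x : S) :
    bucketMean ν z a x =
      (ν.toOuterMeasure {w | (w 0).2.1 = x ∧ snakeReturn w = z ∧ (w 1).1 = a}).toReal := by
  classical
  rw [PMF.toReal_toOuterMeasure_apply]
  refine Finset.sum_congr rfl fun w _ => ?_
  rw [bucketIndicator, mul_ite, mul_one, mul_zero]
  congr!

theorem sum_bucketMean (ν : PMF (Fin (m + 1) → A × S × R)) (z : ℝ) (a : A) :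
    ∑ x, bucketMean ν z a x = nuReturnAction ν z a := by
  classical
  rw [nuReturnAction, PMF.toReal_toOuterMeasure_apply]
  unfold bucketMean
  rw [Finset.sum_comm]
  refine Finset.sum_congr rfl fun w _ => ?_
  rw [← Finset.mul_sum]
  by_cases h : snakeReturn w = z ∧ (w 1).1 = a
  · simp [bucketIndicator, h]
  · have h1 : ∀ x, bucketIndicator z a x w = 0 := fun x => if_neg fun H => h H.2
    simp only [h1, Finset.sum_const_zero, mul_zero]
    exact (if_neg h).symm

theorem bucketMean_mem (ν : PMF (Fin (m + 1) → A × S × R)) (z : ℝ) (a : A) (x : S) :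
    0 ≤ bucketMean ν z a x ∧ bucketMean ν z a x ≤ 1 := by
  refine ⟨by rw [bucketMean_eq]; exact ENNReal.toReal_nonneg, ?_⟩
  have h1 : ∑ w, (ν w).toReal = 1 := by
    rw [← ENNReal.toReal_sum fun w _ => PMF.apply_ne_top _ _,
      ← tsum_fintype (L := .unconditional _), PMF.tsum_coe, ENNReal.toReal_one]
  rw [← h1]
  refine Finset.sum_le_sum fun w _ => mul_le_of_le_one_right ENNReal.toReal_nonneg ?_
  unfold bucketIndicator
  split_ifs <;> norm_num

theorem nuCond_eq (ν : PMF (Fin (m + 1) → A × S × R)) (s : S) (z : ℝ) (a : A) :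
    nuCond ν s z a = bucketMean ν z a s / ∑ x, bucketMean ν z a x := by
  rw [nuCond, sum_bucketMean, bucketMean_eq]

end Bucket

/-! ### From tail bounds to rates -/

section Rate
variable {Ω : Type*} [MeasurableSpace Ω] {P : Measure Ω} [IsProbabilityMeasure P]

/-- A sub-Gaussian tail bound with an arbitrary constant factor gives the rate `n^{-1/2}`. -/
theorem stochasticRateSqrt_of_tail {f : ℕ → Ω → ℝ} {C c : ℝ} (hC : 0 < C) (hc : 0 < c)
    (h : ∀ (n : ℕ) (τ : ℝ), 1 ≤ n → 0 ≤ τ →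
      P.real {ω | τ < |f n ω|} ≤ C * Real.exp (-(n * τ ^ 2 / c))) : StochasticRateSqrt P f := by
  have hlog2 : 0 < Real.log 2 := Real.log_pos one_lt_two
  -- Of the exponent κu, the part u gives δ/2, and the part (C / log 2)u ≥ C outweighs the factor C
  -- because u ≥ log 2.
  set κ := 1 + C / Real.log 2 with hκ
  have hκ0 : 0 < κ := by positivity
  refine ⟨c * κ, by positivity, fun n hn δ hδ hδ1 => ?_⟩
  have hn0 : (0 : ℝ) < n := by exact_mod_cast hn
  set u := Real.log (2 / δ) with hu
  have hu2 : Real.log 2 ≤ u :=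
    Real.log_le_log two_pos (by rw [le_div_iff₀ hδ]; linarith)
  have hu0 : 0 ≤ u := hlog2.le.trans hu2
  set τ := Real.sqrt (c * κ / n * u) with hτ
  have hτ2 : τ ^ 2 = c * κ / n * u := Real.sq_sqrt (by positivity)
  have h1 := h n τ hn (Real.sqrt_nonneg _)
  have h2 : C * Real.exp (-(n * τ ^ 2 / c)) ≤ δ := by
    have e1 : n * τ ^ 2 / c = κ * u := by rw [hτ2]; field_simp
    have e2 : Real.exp (-u) = δ / 2 := by
      rw [hu, ← Real.log_inv, inv_div, Real.exp_log (by positivity)]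
    have e3 : -(κ * u) = -(C / Real.log 2 * u) + -u := by rw [hκ]; ring
    rw [e1, e3, Real.exp_add, e2]
    have h3 : C ≤ C / Real.log 2 * u := by
      rw [div_mul_eq_mul_div, le_div_iff₀ hlog2]
      exact mul_le_mul_of_nonneg_left hu2 hC.le
    have h4 : C * Real.exp (-(C / Real.log 2 * u)) ≤ 1 := by
      rw [Real.exp_neg, ← div_eq_mul_inv, div_le_one (Real.exp_pos _)]
      exact h3.trans (by linarith [Real.add_one_le_exp (C / Real.log 2 * u)])
    rw [← mul_assoc]
    refine (mul_le_mul_of_nonneg_right h4 (by positivity)).trans ?_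
    linarith
  have h5 : (1 : ℝ) ≤ P.real {ω | |f n ω| ≤ τ} + P.real {ω | τ < |f n ω|} := by
    have hun : {ω | |f n ω| ≤ τ} ∪ {ω | τ < |f n ω|} = Set.univ :=
      Set.eq_univ_of_forall fun ω => le_or_gt |f n ω| τ
    have := measureReal_union_le (μ := P) {ω | |f n ω| ≤ τ} {ω | τ < |f n ω|}
    rwa [hun, probReal_univ] at this
  linarith

theorem tendstoInMeasure_of_tail {f : ℕ → Ω → ℝ} {a C c : ℝ} (hc : 0 < c)
    (h : ∀ (n : ℕ) (τ : ℝ), 1 ≤ n → 0 ≤ τ →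
      P.real {ω | τ < |f n ω - a|} ≤ C * Real.exp (-(n * τ ^ 2 / c))) :
    TendstoInMeasure P f atTop fun _ => a := by
  rw [tendstoInMeasure_iff_measureReal_dist]
  intro ε hε
  have hlim : Tendsto (fun n : ℕ => C * Real.exp (-(n * (ε / 2) ^ 2 / c))) atTop (𝓝 0) := by
    have h1 : Tendsto (fun n : ℕ => (n : ℝ) * ((ε / 2) ^ 2 / c)) atTop atTop :=
      tendsto_natCast_atTop_atTop.atTop_mul_const (by positivity)
    have h2 := (Real.tendsto_exp_neg_atTop_nhds_zero.comp h1).const_mul C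
    rw [mul_zero] at h2
    refine h2.congr fun n => ?_
    simp only [Function.comp, mul_div_assoc]
  refine squeeze_zero' (Eventually.of_forall fun _ => measureReal_nonneg) ?_ hlim
  filter_upwards [eventually_ge_atTop 1] with n hn
  refine (measureReal_mono (fun ω hω => ?_) (measure_ne_top _ _)).trans
    (h n (ε / 2) hn (by positivity))
  have : ε ≤ |f n ω - a| := by rw [← Real.dist_eq]; exact hω
  show ε / 2 < |f n ω - a|
  linarith

end Rate

/-! ### The tail of the estimation error -/

/-- Sub-Gaussian tail bound for the error of the factored estimator. -/
theorem exists_factoredCTW_tail {k : ℕ} {B : Fin k → Type*} [∀ i, Fintype (B i)]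
    [∀ i, DecidableEq (B i)] {A : Type*} [Fintype A] [DecidableEq A] {R : Finset ℝ}
    (μ : (∀ i, B i) → A → PMF ((∀ i, B i) × R)) (π : (∀ i, B i) → PMF A) (s₀ : ∀ i, B i)
    (hIR : IrreducibleOn (pairMatrix μ π) (pairSpace μ π s₀)) {m : ℕ} (hm : 1 ≤ m)
    (ν : PMF (Fin (m + 1) → A × (∀ i, B i) × R)) (hν : IsStationarySnake μ π s₀ ν)
    {γ : Fin k → ℝ} (hγ : ∀ i, 0 < γ i ∧ γ i < 1)
    {Ω : Type*} [MeasurableSpace Ω] (P : Measure Ω) [IsProbabilityMeasure P]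
    (Y : ℕ → Ω → A × (∀ i, B i) × R) (hY : IsExecution μ π s₀ P Y)
    (s : ∀ i, B i) (z : ℝ) (a : A) (hza : 0 < nuReturnAction ν z a) :
    ∃ C c : ℝ, 0 < C ∧ 0 < c ∧ ∀ (n : ℕ) (τ : ℝ), 1 ≤ n → 0 ≤ τ →
      P.real {ω | τ < |factoredCTW γ (bucket s₀ m (fun t => Y t ω) z a n) s - nuCond ν s z a|} ≤
        C * Real.exp (-(n * τ ^ 2 / c)) := by
  have : ∀ i, Nonempty (B i) := fun i => ⟨s i⟩
  choose D c hD0 hc0 hconc using fun x =>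
    exists_snake_concentration μ π s₀ hIR ν hν P Y hY (bucketIndicator z a x)
  obtain ⟨L', hL', hL⟩ := exists_abs_factoredCTW_sub_le hγ (fun x => (bucketMean_mem ν z a x).1)
    (by rwa [sum_bucketMean]) s
  -- L' may vanish, and L is divided by.
  set L := L' + 1 with hLdef
  have hL0 : 0 < L := by linarith
  -- Of the extra 2, one unit pays for the state s₀ in the bucket count and one for the term 1/n in
  -- the deterministic estimate.
  set E : ℝ := ∑ x, D x + 2 with hE
  set c₀ : ℝ := ∑ x, c x with hc₀
  have hcx : ∀ x, c x ≤ c₀ := fun x =>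
    Finset.single_le_sum (f := c) (fun x _ => (hc0 x).le) (Finset.mem_univ x)
  have hDx : ∀ x, D x + 2 ≤ E := fun x => by
    have := Finset.single_le_sum (f := D) (fun x _ => hD0 x) (Finset.mem_univ x)
    linarith
  have hc₀0 : 0 < c₀ := (hc0 s).trans_le (hcx s)
  set N : ℝ := (Fintype.card (∀ i, B i) : ℝ) with hN
  have hN1 : 1 ≤ N := by rw [hN]; exact_mod_cast Fintype.card_pos
  refine ⟨N * 2 * Real.exp (E ^ 2 / c₀), 2 * L ^ 2 * c₀, by positivity, by positivity,
    fun n τ hn hτ => ?_⟩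
  have hn0 : (0 : ℝ) < n := by exact_mod_cast hn
  have hn1 : (1 : ℝ) ≤ n := by exact_mod_cast hn
  have hexp : n * τ ^ 2 / (2 * L ^ 2 * c₀) = (n * τ / L) ^ 2 / (2 * (c₀ * n)) := by
    field_simp
  rw [hexp, mul_assoc, ← Real.exp_add]
  set b := n * τ / L with hb
  have hb0 : 0 ≤ b := by positivity
  have hEn : E ^ 2 / (c₀ * n) ≤ E ^ 2 / c₀ :=
    div_le_div_of_nonneg_left (sq_nonneg E) hc₀0 (le_mul_of_one_le_right hc₀0.le hn1)
  -- b = nτ/L is the deviation of the counts that the error τ permits. Below E the factor exp(E²/c₀)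
  -- makes the bound at least 1; above E the concentration bound applies with t = b - E.
  rcases lt_or_ge b E with hbE | hbE
  · have h1 : b ^ 2 / (2 * (c₀ * n)) ≤ E ^ 2 / (c₀ * n) := by
      have h2 : b ^ 2 ≤ E ^ 2 := pow_le_pow_left₀ hb0 hbE.le 2
      calc b ^ 2 / (2 * (c₀ * n)) ≤ E ^ 2 / (2 * (c₀ * n)) := by gcongr
        _ ≤ E ^ 2 / (c₀ * n) := by
          refine div_le_div_of_nonneg_left (sq_nonneg E) (by positivity) ?_
          have : 0 < c₀ * n := by positivity
          linarith
    have h2 : 1 ≤ Real.exp (E ^ 2 / c₀ + -(b ^ 2 / (2 * (c₀ * n)))) :=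
      Real.one_le_exp (by linarith)
    refine measureReal_le_one.trans ?_
    nlinarith
  · obtain ⟨T, rfl⟩ : ∃ T, n = T + 1 := ⟨n - 1, by omega⟩
    set t := b - E with ht
    have ht0 : 0 ≤ t := sub_nonneg.2 hbE
    have hsub : {ω | τ < |factoredCTW γ (bucket s₀ m (fun t => Y t ω) z a (T + 1)) s -
        nuCond ν s z a|} ⊆ ⋃ x ∈ (Finset.univ : Finset (∀ i, B i)),
        {ω | D x + t < |∑ j ∈ Finset.range T, (bucketIndicator z a x (window m j fun i => Y i ω) -
          ∑ w, (ν w).toReal * bucketIndicator z a x w)|} := by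
      intro ω hω
      by_contra hcon
      simp only [Set.mem_iUnion, Finset.mem_univ, exists_prop, true_and, not_exists] at hcon
      have hε : 0 ≤ (b - 1) / ((T + 1 : ℕ) : ℝ) :=
        div_nonneg (by linarith [hDx s, hD0 s]) hn0.le
      have hclose := hL (bucket s₀ m (fun t => Y t ω) z a (T + 1)) ((T + 1 : ℕ) : ℝ)
        ((b - 1) / ((T + 1 : ℕ) : ℝ)) hn0 hε fun x => by
          rw [div_mul_cancel₀ _ hn0.ne']
          refine (abs_countWeight_bucket_sub_le hm s₀ (fun t => Y t ω) z a T x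
            (bucketMean_mem ν z a x)).trans ?_
          have h1 : |∑ j ∈ Finset.range T, (bucketIndicator z a x (window m j fun i => Y i ω) -
            bucketMean ν z a x)| ≤ D x + t := not_lt.1 (hcon x)
          linarith [hDx x]
      rw [← nuCond_eq, ← add_div, sub_add_cancel] at hclose
      have h1 : L' * (b / ((T + 1 : ℕ) : ℝ)) ≤ L * (b / ((T + 1 : ℕ) : ℝ)) :=
        mul_le_mul_of_nonneg_right (by linarith) (by positivity)
      have h2 : L * (b / ((T + 1 : ℕ) : ℝ)) = τ := by rw [hb]; field_simp
      exact absurd (hclose.trans (h1.trans_eq h2)) (not_le.2 hω)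
    refine (measureReal_mono hsub (measure_ne_top _ _)).trans
      ((measureReal_biUnion_finset_le _ _).trans ?_)
    have hx : ∀ x ∈ (Finset.univ : Finset (∀ i, B i)),
        P.real {ω | D x + t < |∑ j ∈ Finset.range T,
          (bucketIndicator z a x (window m j fun i => Y i ω) -
            ∑ w, (ν w).toReal * bucketIndicator z a x w)|} ≤
        2 * Real.exp (E ^ 2 / c₀ + -(b ^ 2 / (2 * (c₀ * ((T + 1 : ℕ) : ℝ))))) := by
      intro x _
      refine (hconc x T (T + 1) t (Nat.le_succ T) hn ht0).trans ?_
      refine mul_le_mul_of_nonneg_left (Real.exp_le_exp.2 ?_) zero_le_two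
      have h1 : t ^ 2 / (c₀ * ((T + 1 : ℕ) : ℝ)) ≤ t ^ 2 / (c x * ((T + 1 : ℕ) : ℝ)) :=
        div_le_div_of_nonneg_left (sq_nonneg t) (mul_pos (hc0 x) hn0)
          (mul_le_mul_of_nonneg_right (hcx x) hn0.le)
      have h2 : b ^ 2 / (2 * (c₀ * ((T + 1 : ℕ) : ℝ))) - E ^ 2 / (c₀ * ((T + 1 : ℕ) : ℝ)) ≤
          t ^ 2 / (c₀ * ((T + 1 : ℕ) : ℝ)) := by
        have hp : 0 < c₀ * ((T + 1 : ℕ) : ℝ) := by positivity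
        have e : b ^ 2 / (2 * (c₀ * ((T + 1 : ℕ) : ℝ))) - E ^ 2 / (c₀ * ((T + 1 : ℕ) : ℝ)) =
            (b ^ 2 / 2 - E ^ 2) / (c₀ * ((T + 1 : ℕ) : ℝ)) := by field_simp
        rw [e]
        refine div_le_div_of_nonneg_right ?_ hp.le
        rw [ht]
        -- (b - E)² - (b²/2 - E²) = (b - 2E)²/2.
        nlinarith [sq_nonneg (b - 2 * E)]
      linarith
    refine (Finset.sum_le_sum hx).trans_eq ?_
    rw [Finset.sum_const, Finset.card_univ, nsmul_eq_mul, hN]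
    ring

theorem theorem3 {k : ℕ} {B : Fin k → Type*} [∀ i, Fintype (B i)] [∀ i, DecidableEq (B i)]
    {A : Type*} [Fintype A] [DecidableEq A] {R : Finset ℝ}
    (μ : (∀ i, B i) → A → PMF ((∀ i, B i) × R)) (π : (∀ i, B i) → PMF A) (s₀ : ∀ i, B i)
    (hIR : IrreducibleOn (pairMatrix μ π) (pairSpace μ π s₀))
    (hEA : EssAperiodicOn (pairMatrix μ π) (pairSpace μ π s₀))
    (m : ℕ) (hm : 1 ≤ m)
    (ν : PMF (Fin (m + 1) → A × (∀ i, B i) × R)) (hν : IsStationarySnake μ π s₀ ν)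
    (γ : Fin k → ℝ) (hγ : ∀ i, 0 < γ i ∧ γ i < 1)
    {Ω : Type*} [MeasurableSpace Ω] (P : Measure Ω) [IsProbabilityMeasure P]
    (Y : ℕ → Ω → A × (∀ i, B i) × R) (hY : IsExecution μ π s₀ P Y)
    (s : ∀ i, B i) (z : ℝ) (a : A) (hza : 0 < nuReturnAction ν z a) :
    TendstoInMeasure P
        (fun n ω => factoredCTW γ (bucket s₀ m (fun t => Y t ω) z a n) s)
        atTop (fun _ => nuCond ν s z a) ∧
      StochasticRateSqrt P
        (fun n ω => |factoredCTW γ (bucket s₀ m (fun t => Y t ω) z a n) s - nuCond ν s z a|) := by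
  obtain ⟨C, c, hC, hc, h⟩ := exists_factoredCTW_tail μ π s₀ hIR hm ν hν hγ P Y hY s z a hza
  exact ⟨tendstoInMeasure_of_tail hc h,
    stochasticRateSqrt_of_tail hC hc (by simpa only [abs_abs] using h)⟩
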